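/- **Proposition** ($\lim_{\varepsilon\to0}Q_\varepsilon(T)=Q(T)$). All Hilbert spaces are nonzero and finite dimensional, written $\mathbb C^d$ with a fixed orthonormal basis, and $\mathcal B(\mathbb C^d)=M_d(\mathbb C)$ carries the operator norm. A *channel* $T:\mathcal B(\mathbb C^{d_2})\to\mathcal B(\mathbb C^{d_1})$ is a completely positive, unital linear map. For a linear map $T:\mathcal B(\mathbb C^{d_2})\to\mathcal B(\mathbb C^{d_1})$ let $$\|T\|_{\rm cb}=\sup\bigl\{\|(T\otimes\mathrm{id}_n)(A)\| : n\in\mathbb N,\ A\in\mathcal B(\mathbb C^{d_2}\otimes\mathbb C^n),\ \|A\|\le 1\bigr\},$$ and for an integer $M\ge1$ let $$\Delta(T,M)=\inf_{E,D}\|E\,T\,D-\mathrm{id}_{\mathcal B(\mathbb C^M)}\|_{\rm cb},$$ where the infimum is over all channels $D:\mathcal B(\mathbb C^M)\to\mathcal B(\mathbb C^{d_2})$ and $E:\mathcal B(\mathbb C^{d_1})\to\mathcal B(\mathbb C^M)$. The quantum capacity $Q(T)\in[0,\infty]$ is the supremum of all real $c\ge0$ with $$\lim_{n\to\infty}\Delta\bigl(T^{\otimes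 n},\lfloor 2^{cn}\rfloor\bigr)=0 .$$ For $\varepsilon>0$, the capacity with finite error $Q_\varepsilon(T)\in[0,\infty]$ is the supremum of all real $c\ge0$ such that $\Delta\bigl(T^{\otimes n},2^{\lfloor cn\rfloor}\bigr)\le\varepsilon$ for all sufficiently large $n$. Then for every channel $T$, with $d_1,d_2$ not necessarily equal, $$\lim_{\varepsilon\to0,\ \varepsilon>0}Q_\varepsilon(T)=Q(T).$$ -/

import Mathlib

/-!
Finite-dimensional quantum channels in the Heisenberg picture, their cb-norm, tensor powers,
coding errors and quantum capacities.  The Hilbert space with orthonormal basis indexed by a finite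
type `κ` is `ℂ^κ`, and its observable algebra `B(ℂ^κ)` is `Matrix κ κ ℂ` with the operator norm.
-/

namespace QuantumCapacity

open Filter Topology
open scoped ENNReal NNReal ComplexOrder Matrix.Norms.L2Operator MatrixOrder CStarAlgebra

/-- `T : B(ℂ^κ) → B(ℂ^ι)` is a quantum channel (Heisenberg picture): it is completely positive
and unital.  The algebras carry the operator norm and the positive-semidefinite order. -/
def IsChannel {κ ι : Type*} [Fintype κ] [DecidableEq κ] [Fintype ι] [DecidableEq ι]
    (T : Matrix κ κ ℂ →ₗ[ℂ] Matrix ι ι ℂ) : Prop :=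
  (∃ Φ : Matrix κ κ ℂ →CP Matrix ι ι ℂ, Φ.toLinearMap = T) ∧ T 1 = 1

/-- The map `T ⊗ id_n : B(ℂ^κ ⊗ ℂ^n) → B(ℂ^ι ⊗ ℂ^n)`: apply `T` to each of the `n × n` blocks. -/
def ampliation {κ ι : Type*} (T : Matrix κ κ ℂ →ₗ[ℂ] Matrix ι ι ℂ) (n : ℕ) :
    Matrix (κ × Fin n) (κ × Fin n) ℂ →ₗ[ℂ] Matrix (ι × Fin n) (ι × Fin n) ℂ where
  toFun A := Matrix.of fun x y =>
    T (Matrix.of fun a b => A (a, x.2) (b, y.2)) x.1 y.1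
  map_add' A B := by
    ext x y
    exact congrFun (congrFun (map_add T (Matrix.of fun a b => A (a, x.2) (b, y.2))
      (Matrix.of fun a b => B (a, x.2) (b, y.2))) x.1) y.1
  map_smul' c A := by
    ext x y
    exact congrFun (congrFun (map_smul T c (Matrix.of fun a b => A (a, x.2) (b, y.2))) x.1) y.1

open scoped Kronecker in
/-- `(T ⊗ id_n)(X ⊗ Y) = T(X) ⊗ Y`. -/
theorem ampliation_kronecker {κ ι : Type*} (T : Matrix κ κ ℂ →ₗ[ℂ] Matrix ι ι ℂ) (n : ℕ)
    (X : Matrix κ κ ℂ) (Y : Matrix (Fin n) (Fin n) ℂ) :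
    ampliation T n (X ⊗ₖ Y) = T X ⊗ₖ Y := by
  ext x y
  have h : (Matrix.of fun a b => (X ⊗ₖ Y) (a, x.2) (b, y.2)) = Y x.2 y.2 • X := by
    ext a b
    simp [Matrix.kroneckerMap_apply, mul_comm]
  calc ampliation T n (X ⊗ₖ Y) x y = T (Y x.2 y.2 • X) x.1 y.1 := by rw [← h]; rfl
    _ = (T X ⊗ₖ Y) x y := by simp [Matrix.kroneckerMap_apply, mul_comm]

/-- The `n × n` matrix over `B(ℂ^κ)` formed by the blocks of an operator on `ℂ^κ ⊗ ℂ^n`. -/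
def toBlocks {κ : Type*} (n : ℕ) (A : Matrix (κ × Fin n) (κ × Fin n) ℂ) :
    CStarMatrix (Fin n) (Fin n) (Matrix κ κ ℂ) :=
  CStarMatrix.ofMatrix (Matrix.of fun p q => Matrix.of fun a b => A (a, p) (b, q))

theorem toBlocks_conjTranspose_mul {κ : Type*} [Fintype κ] [DecidableEq κ] (n : ℕ)
    (B : Matrix (κ × Fin n) (κ × Fin n) ℂ) :
    toBlocks n (B.conjTranspose * B) = star (toBlocks n B) * toBlocks n B := by
  ext p q a b
  rw [CStarMatrix.mul_apply, Matrix.sum_apply]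
  simp only [toBlocks, CStarMatrix.star_apply, CStarMatrix.ofMatrix_apply, Matrix.of_apply,
    Matrix.mul_apply, Matrix.star_apply, Matrix.conjTranspose_apply]
  rw [Fintype.sum_prod_type_right]

theorem toBlocks_nonneg_iff {κ : Type*} [Fintype κ] [DecidableEq κ] (n : ℕ)
    (A : Matrix (κ × Fin n) (κ × Fin n) ℂ) : 0 ≤ toBlocks n A ↔ A.PosSemidef := by
  constructor
  · intro h
    let g : CStarMatrix (Fin n) (Fin n) (Matrix κ κ ℂ) → Matrix (κ × Fin n) (κ × Fin n) ℂ :=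
      fun M => Matrix.of fun x y => M x.2 y.2 x.1 y.1
    have hg : ∀ M, toBlocks n (g M) = M := fun M => rfl
    have hg' : ∀ B, g (toBlocks n B) = B := fun B => rfl
    have key : ∀ M, M ∈ AddSubmonoid.closure
        (Set.range fun s : CStarMatrix (Fin n) (Fin n) (Matrix κ κ ℂ) => star s * s) →
        (g M).PosSemidef := by
      intro M hM
      induction hM using AddSubmonoid.closure_induction with
      | mem M hM =>
        obtain ⟨N, rfl⟩ := hM
        have : star N * N = toBlocks n ((g N).conjTranspose * g N) := by
          rw [toBlocks_conjTranspose_mul, hg]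
        simp only [this, hg']
        exact Matrix.posSemidef_conjTranspose_mul_self _
      | zero => exact Matrix.PosSemidef.zero
      | add M N _ _ h1 h2 => exact h1.add h2
    exact key _ (StarOrderedRing.nonneg_iff.mp h)
  · intro h
    obtain ⟨B, hB⟩ := CStarAlgebra.nonneg_iff_eq_star_mul_self.mp h.nonneg
    rw [hB, Matrix.star_eq_conjTranspose, toBlocks_conjTranspose_mul]
    exact star_mul_self_nonneg _

theorem toBlocks_ampliation {κ ι : Type*} (T : Matrix κ κ ℂ →ₗ[ℂ] Matrix ι ι ℂ) (n : ℕ)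
    (A : Matrix (κ × Fin n) (κ × Fin n) ℂ) :
    toBlocks n (ampliation T n A) = (toBlocks n A).map T := rfl

/-- A channel is a unital map all of whose ampliations `T ⊗ id_n` are positive. -/
theorem isChannel_iff {κ ι : Type*} [Fintype κ] [DecidableEq κ] [Fintype ι] [DecidableEq ι]
    (T : Matrix κ κ ℂ →ₗ[ℂ] Matrix ι ι ℂ) :
    IsChannel T ↔ (∀ (n : ℕ) (A : Matrix (κ × Fin n) (κ × Fin n) ℂ),
      A.PosSemidef → (ampliation T n A).PosSemidef) ∧ T 1 = 1 := by
  refine and_congr_left fun _ => ⟨?_, fun h => ?_⟩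
  · rintro ⟨Φ, rfl⟩ n A hA
    have h0 := Φ.map_cstarMatrix_nonneg' n _ ((toBlocks_nonneg_iff n A).mpr hA)
    have h1 := toBlocks_ampliation Φ.toLinearMap n A
    rw [← toBlocks_nonneg_iff, h1]
    exact h0
  · refine ⟨⟨T, fun n M hM => ?_⟩, rfl⟩
    obtain ⟨A, rfl⟩ : ∃ A, toBlocks n A = M := ⟨Matrix.of fun x y => M x.2 y.2 x.1 y.1, rfl⟩
    have h1 := toBlocks_ampliation T n A
    have h2 := (toBlocks_nonneg_iff n _).mpr (h n A ((toBlocks_nonneg_iff n A).mp hM))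
    rw [h1] at h2
    exact h2

/-- The norm of complete boundedness
`‖T‖_cb = sup { ‖(T ⊗ id_n)(A)‖ : n ∈ ℕ, A ∈ B(ℂ^κ ⊗ ℂ^n), ‖A‖ ≤ 1 }`, in `[0, ∞]`. -/
noncomputable def cbNorm {κ ι : Type*} [Fintype κ] [DecidableEq κ] [Fintype ι] [DecidableEq ι]
    (T : Matrix κ κ ℂ →ₗ[ℂ] Matrix ι ι ℂ) : ℝ≥0∞ :=
  ⨆ (n : ℕ) (A : Matrix (κ × Fin n) (κ × Fin n) ℂ) (_ : ‖A‖ ≤ 1), ‖ampliation T n A‖ₑ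

/-- The tensor power `T^{⊗n} : B((ℂ^κ)^{⊗n}) → B((ℂ^ι)^{⊗n})`, with `(ℂ^κ)^{⊗n} = ℂ^(κⁿ)`,
written through its values `T^{⊗n}(⊗ᵢ E_{aᵢ bᵢ}) = ⊗ᵢ T(E_{aᵢ bᵢ})` on matrix units. -/
noncomputable def tensorPower {κ ι : Type*} [Fintype κ] [DecidableEq κ]
    (T : Matrix κ κ ℂ →ₗ[ℂ] Matrix ι ι ℂ) (n : ℕ) :
    Matrix (Fin n → κ) (Fin n → κ) ℂ →ₗ[ℂ] Matrix (Fin n → ι) (Fin n → ι) ℂ where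
  toFun A := Matrix.of fun x y =>
    ∑ a : Fin n → κ, ∑ b : Fin n → κ,
      A a b * ∏ i : Fin n, T (Matrix.single (a i) (b i) 1) (x i) (y i)
  map_add' A B := by
    ext x y
    simp [add_mul, Finset.sum_add_distrib]
  map_smul' c A := by
    ext x y
    simp [mul_assoc, Finset.mul_sum]

/-- `T^{⊗n}(X₁ ⊗ ⋯ ⊗ Xₙ) = T(X₁) ⊗ ⋯ ⊗ T(Xₙ)`. -/
theorem tensorPower_prod {κ ι : Type*} [Fintype κ] [DecidableEq κ]
    (T : Matrix κ κ ℂ →ₗ[ℂ] Matrix ι ι ℂ) (n : ℕ) (X : Fin n → Matrix κ κ ℂ) :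
    tensorPower T n (Matrix.of fun a b => ∏ i, X i (a i) (b i)) =
      Matrix.of fun x y => ∏ i, T (X i) (x i) (y i) := by
  have hT : ∀ (Z : Matrix κ κ ℂ) (u v : ι),
      T Z u v = ∑ a, ∑ b, Z a b * T (Matrix.single a b 1) u v := by
    intro Z u v
    conv_lhs => rw [Matrix.matrix_eq_sum_single Z]
    simp only [map_sum, Matrix.sum_apply]
    refine Finset.sum_congr rfl fun a _ => Finset.sum_congr rfl fun b _ => ?_
    have : Matrix.single a b (Z a b) = Z a b • Matrix.single a b (1 : ℂ) := by simp
    rw [this, map_smul, Matrix.smul_apply, smul_eq_mul]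
  ext x y
  simp only [tensorPower, LinearMap.coe_mk, AddHom.coe_mk, Matrix.of_apply]
  simp_rw [hT (X _), Finset.prod_univ_sum, Fintype.piFinset_univ, ← Finset.prod_mul_distrib]

/-- The best error level for coding an `M`-level system through `T`:
`Δ(T, M) = inf ‖E T D - id‖_cb` over all encodings (channels) `E : B(ℂ^ι) → B(ℂ^M)` and all
decodings (channels) `D : B(ℂ^M) → B(ℂ^κ)`. -/
noncomputable def codingError {κ ι : Type*} [Fintype κ] [DecidableEq κ] [Fintype ι]
    [DecidableEq ι] (T : Matrix κ κ ℂ →ₗ[ℂ] Matrix ι ι ℂ) (M : ℕ) : ℝ≥0∞ :=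
  ⨅ (E : Matrix ι ι ℂ →ₗ[ℂ] Matrix (Fin M) (Fin M) ℂ)
    (D : Matrix (Fin M) (Fin M) ℂ →ₗ[ℂ] Matrix κ κ ℂ)
    (_ : IsChannel E) (_ : IsChannel D), cbNorm (E ∘ₗ T ∘ₗ D - LinearMap.id)

/-- `c ≥ 0` is an achievable rate for `T` if `Δ(T^{⊗n}, ⌊2^{cn}⌋) → 0` as `n → ∞`. -/
def IsAchievableRate {κ ι : Type*} [Fintype κ] [DecidableEq κ] [Fintype ι] [DecidableEq ι]
    (T : Matrix κ κ ℂ →ₗ[ℂ] Matrix ι ι ℂ) (c : ℝ≥0) : Prop :=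
  Tendsto (fun n : ℕ => codingError (tensorPower T n) ⌊(2 : ℝ) ^ ((c : ℝ) * n)⌋₊) atTop (𝓝 0)

/-- The quantum capacity `Q(T) ∈ [0, ∞]`: the supremum of all achievable rates. -/
noncomputable def capacity {κ ι : Type*} [Fintype κ] [DecidableEq κ] [Fintype ι] [DecidableEq ι]
    (T : Matrix κ κ ℂ →ₗ[ℂ] Matrix ι ι ℂ) : ℝ≥0∞ :=
  ⨆ (c : ℝ≥0) (_ : IsAchievableRate T c), (c : ℝ≥0∞)

/-- `c ≥ 0` is achievable for `T` with finite error `ε` if `Δ(T^{⊗n}, 2^{⌊cn⌋}) ≤ ε` for all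
large `n`. -/
def IsAchievableRateWithError {κ ι : Type*} [Fintype κ] [DecidableEq κ] [Fintype ι]
    [DecidableEq ι] (ε : ℝ) (T : Matrix κ κ ℂ →ₗ[ℂ] Matrix ι ι ℂ) (c : ℝ≥0) : Prop :=
  ∀ᶠ n : ℕ in atTop,
    codingError (tensorPower T n) (2 ^ ⌊(c : ℝ) * n⌋₊) ≤ ENNReal.ofReal ε

/-- The capacity with finite error allowed, `Q_ε(T) ∈ [0, ∞]`: the supremum of all rates that are
achievable with error `ε`. -/
noncomputable def capacityWithError {κ ι : Type*} [Fintype κ] [DecidableEq κ] [Fintype ι]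
    [DecidableEq ι] (ε : ℝ) (T : Matrix κ κ ℂ →ₗ[ℂ] Matrix ι ι ℂ) : ℝ≥0∞ :=
  ⨆ (c : ℝ≥0) (_ : IsAchievableRateWithError ε T c), (c : ℝ≥0∞)

end QuantumCapacity

/-!
The inequality `Q ≤ Q_ε` is immediate, since `2^⌊cn⌋ ≤ ⌊2^(cn)⌋` and a smaller system can be coded
whenever a larger one can (`codingError_mono`).

For the converse, suppose that for large `n` the channel `T^{⊗n}` can be turned by coding into a map
`R` on `l = ⌊cn⌋` qubits with `‖R - id‖_cb ≤ δ`. Use `m` such blocks as the letters of a quantum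
error-correcting code over an alphabet of `q = 2^l` symbols. In the binomial expansion
`R^{⊗m} = ∑_S (R - id)^{⊗S} ⊗ id` (`piTensor_eq_sum_powerset`) a term with `0 < |S| ≤ t` is turned
by a `t`-error-correcting code into a multiple of the identity. This multiple is `0` because
`R - id` annihilates `1`. The term `S = ∅` gives the identity, and the remaining terms have total
cb-norm at most `2^m δ^(t+1)` (`IsErrorCorrecting.exists_cbBound`).

As `m` is fixed while `n` and hence `q` grow, `m ≤ q` may be assumed, so that quantum Reed–Solomon
codes are available: they have `m - 4t` logical letters
(`exists_isErrorCorrecting`). The Knill–Laflamme condition for the states `∑ y, |enc x y⟩`, with `x`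
the high and `y` the low coefficients of a polynomial, follows from two properties of polynomial
evaluation: a polynomial of degree less than `m - 2t` is determined by `m - 2t` of its values, and
any `2t` values are independent of `x` when `y` is uniformly random. The decoder comes from a
generalized inverse square root of the Gram matrix of the errors
(`QuantumCapacity.exists_decoder`).

With `m = (s + 4) t` the error is at most `(2^(s+4) δ)^t`, which is small for large `t` if
`2^(s+4) δ < 1`, and the rate is multiplied by `s / (s + 4)`. Taking `δ = 2ε` gives
`Q_ε ≤ (1 + 4/s) Q` for all `s` with `2^(s+5) ε < 1` (`capacityWithError_le`), whence the limit.
-/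

namespace QuantumCapacity

open Filter Topology
open scoped ENNReal NNReal ComplexOrder Matrix.Norms.L2Operator MatrixOrder CStarAlgebra

/-! ### Kraus representations -/

theorem apply_eq_sum_single {κ ι : Type*} [Fintype κ] [DecidableEq κ]
    (T : Matrix κ κ ℂ →ₗ[ℂ] Matrix ι ι ℂ)
    (Z : Matrix κ κ ℂ) (u v : ι) :
    T Z u v = ∑ a, ∑ b, Z a b * T (Matrix.single a b 1) u v := by
  conv_lhs => rw [Matrix.matrix_eq_sum_single Z]
  simp only [map_sum, Matrix.sum_apply]
  refine Finset.sum_congr rfl fun a _ => Finset.sum_congr rfl fun b _ => ?_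
  have : Matrix.single a b (Z a b) = Z a b • Matrix.single a b (1 : ℂ) := by simp
  rw [this, map_smul, Matrix.smul_apply, smul_eq_mul]

/-- The completely positive map with given Kraus operators. -/
noncomputable def krausMap {κ ι σ : Type*} [Fintype κ] [Fintype σ] (K : σ → Matrix κ ι ℂ) :
    Matrix κ κ ℂ →ₗ[ℂ] Matrix ι ι ℂ where
  toFun X := ∑ k, (K k).conjTranspose * X * K k
  map_add' X Y := by simp [Matrix.mul_add, Matrix.add_mul, Finset.sum_add_distrib]
  map_smul' c X := by simp [Finset.smul_sum]

/-- The conjugation `X ↦ Vᴴ X V`. -/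
noncomputable def conjMap {κ ι : Type*} [Fintype κ] (V : Matrix κ ι ℂ) :
    Matrix κ κ ℂ →ₗ[ℂ] Matrix ι ι ℂ where
  toFun X := V.conjTranspose * X * V
  map_add' X Y := by simp [Matrix.mul_add, Matrix.add_mul]
  map_smul' c X := by simp

theorem conjMap_apply {κ ι : Type*} [Fintype κ] (V : Matrix κ ι ℂ)
    (X : Matrix κ κ ℂ) :
    conjMap V X = V.conjTranspose * X * V := rfl

/-- The ampliation of `X ↦ ∑ Kᴴ X K` has the Kraus operators `K ⊗ 1`. -/
theorem ampliation_eq_kraus {κ ι σ : Type*} [Fintype κ] [Fintype σ]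
    {T : Matrix κ κ ℂ →ₗ[ℂ] Matrix ι ι ℂ}
    (K : σ → Matrix κ ι ℂ) (hK : ∀ X, T X = ∑ k, (K k).conjTranspose * X * K k) (n : ℕ)
    (A : Matrix (κ × Fin n) (κ × Fin n) ℂ) :
    ampliation T n A =
      ∑ k, (Matrix.kroneckerMap (· * ·) (K k) (1 : Matrix (Fin n) (Fin n) ℂ)).conjTranspose * A *
        Matrix.kroneckerMap (· * ·) (K k) (1 : Matrix (Fin n) (Fin n) ℂ) := by
  ext x y
  change T _ x.1 y.1 = _
  rw [hK]
  simp [Matrix.sum_apply, Matrix.mul_apply, Fintype.sum_prod_type, Matrix.one_apply, apply_ite]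

section Kraus

variable {κ ι : Type*} [Fintype κ] [DecidableEq κ] [Fintype ι] [DecidableEq ι]

/-- Every channel has a Kraus decomposition; the Kraus operators are read off from a decomposition
of the (positive semidefinite) Choi matrix into rank-one terms. -/
theorem IsChannel.exists_kraus {T : Matrix κ κ ℂ →ₗ[ℂ] Matrix ι ι ℂ} (hT : IsChannel T) :
    ∃ (r : ℕ) (K : Fin r → Matrix κ ι ℂ), ∀ X, T X = ∑ k, (K k).conjTranspose * X * K k := by
  rw [isChannel_iff] at hT
  let e := Fintype.equivFin κ
  let ω : κ × Fin (Fintype.card κ) → ℂ := fun x => if e x.1 = x.2 then 1 else 0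
  have hC := hT.1 _ _ (Matrix.posSemidef_vecMulVec_self_star ω)
  obtain ⟨r, v, hv⟩ := Matrix.posSemidef_iff_eq_sum_vecMulVec.mp hC
  have key : ∀ a b x y, T (Matrix.single a b 1) x y = ∑ k, v k (x, e a) * star (v k (y, e b)) := by
    intro a b x y
    have h := congrFun (congrFun hv (x, e a)) (y, e b)
    simp only [Matrix.sum_apply, Matrix.vecMulVec_apply, Pi.star_apply] at h
    rw [← h]
    change _ = T _ x y
    refine congrArg (fun Z => T Z x y) (Matrix.ext fun a' b' => ?_)
    simp only [Matrix.single_apply, Matrix.of_apply, Matrix.vecMulVec_apply, ω, Pi.star_apply,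
      EmbeddingLike.apply_eq_iff_eq, eq_comm (a := a), eq_comm (a := b)]
    split_ifs <;> simp_all
  refine ⟨r, fun k => Matrix.of fun a x => star (v k (x, e a)), fun X => ?_⟩
  ext x y
  rw [apply_eq_sum_single]
  simp only [key, Matrix.sum_apply, Matrix.mul_apply, Matrix.conjTranspose_apply, Matrix.of_apply,
    star_star, Finset.mul_sum, Finset.sum_mul]
  rw [Finset.sum_comm, Finset.sum_comm_cycle]
  exact Finset.sum_congr rfl fun k _ => Finset.sum_congr rfl fun a _ =>
    Finset.sum_congr rfl fun b _ => by ring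

theorem IsChannel.map_one {T : Matrix κ κ ℂ →ₗ[ℂ] Matrix ι ι ℂ} (hT : IsChannel T) : T 1 = 1 :=
  hT.2

/-- A unital map given by Kraus operators is a channel. -/
theorem isChannel_of_kraus {σ : Type*} [Fintype σ] {T : Matrix κ κ ℂ →ₗ[ℂ] Matrix ι ι ℂ}
    (K : σ → Matrix κ ι ℂ) (hK : ∀ X, T X = ∑ k, (K k).conjTranspose * X * K k) (h1 : T 1 = 1) :
    IsChannel T := by
  rw [isChannel_iff]
  refine ⟨fun n A hA => ?_, h1⟩
  rw [ampliation_eq_kraus K hK]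
  exact Matrix.posSemidef_sum _ fun k _ => hA.conjTranspose_mul_mul_same _

theorem IsChannel.ampliation {T : Matrix κ κ ℂ →ₗ[ℂ] Matrix ι ι ℂ} (hT : IsChannel T) (n : ℕ) :
    IsChannel (ampliation T n) := by
  obtain ⟨r, K, hK⟩ := hT.exists_kraus
  refine isChannel_of_kraus _ (ampliation_eq_kraus K hK n) ?_
  have := ampliation_kronecker T n 1 1
  rwa [hT.map_one, Matrix.one_kronecker_one, Matrix.one_kronecker_one] at this

theorem isChannel_id : IsChannel (LinearMap.id : Matrix κ κ ℂ →ₗ[ℂ] Matrix κ κ ℂ) :=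
  isChannel_of_kraus (fun _ : Unit => 1) (by simp) rfl

theorem IsChannel.comp {τ : Type*} [Fintype τ] [DecidableEq τ]
    {S : Matrix ι ι ℂ →ₗ[ℂ] Matrix τ τ ℂ} {T : Matrix κ κ ℂ →ₗ[ℂ] Matrix ι ι ℂ}
    (hS : IsChannel S) (hT : IsChannel T) : IsChannel (S ∘ₗ T) := by
  rw [isChannel_iff] at *
  exact ⟨fun n A hA => hS.1 n _ (hT.1 n A hA), by simp [hS.2, hT.2]⟩

theorem isChannel_conjMap {V : Matrix κ ι ℂ} (hV : V.conjTranspose * V = 1) :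
    IsChannel (conjMap V) :=
  isChannel_of_kraus (fun _ : Unit => V) (by simp [conjMap_apply]) (by simp [conjMap_apply, hV])

/-- A completely positive map `X ↦ ∑ Kᴴ X K` with `∑ Kᴴ K ≤ 1` becomes a channel when the missing
part of the identity is added with the vector state at a basis vector `o`. -/
theorem exists_channel_of_subunital {σ : Type*} [Fintype σ] (K : σ → Matrix κ ι ℂ)
    (hK : (1 - ∑ k, (K k).conjTranspose * K k).PosSemidef) (o : κ) :
    ∃ D : Matrix κ κ ℂ →ₗ[ℂ] Matrix ι ι ℂ, IsChannel D ∧ ∀ X, D X =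
      ∑ k, (K k).conjTranspose * X * K k + X o o • (1 - ∑ k, (K k).conjTranspose * K k) := by
  obtain ⟨B, hB⟩ := CStarAlgebra.nonneg_iff_eq_star_mul_self.mp hK.nonneg
  rw [Matrix.star_eq_conjTranspose] at hB
  let L : ι → Matrix κ ι ℂ := fun j => Matrix.of fun a x => if a = o then B j x else 0
  have hL : ∀ X : Matrix κ κ ℂ, ∑ j, (L j).conjTranspose * X * L j =
      X o o • (1 - ∑ k, (K k).conjTranspose * K k) := by
    intro X
    rw [hB]
    ext x y
    simp only [Matrix.sum_apply, Matrix.mul_apply, Matrix.conjTranspose_apply, Matrix.of_apply, L,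
      Matrix.smul_apply, smul_eq_mul, Finset.mul_sum, apply_ite star, star_zero, ite_mul, zero_mul,
      mul_ite, mul_zero, Finset.sum_ite_eq', Finset.mem_univ, if_true]
    exact Finset.sum_congr rfl fun _ _ => by ring
  have hD : ∀ X, krausMap (Sum.elim K L) X =
      ∑ k, (K k).conjTranspose * X * K k + X o o • (1 - ∑ k, (K k).conjTranspose * K k) := by
    intro X
    rw [← hL]
    exact Fintype.sum_sum_type _
  refine ⟨krausMap (Sum.elim K L), isChannel_of_kraus _ (fun X => rfl) ?_, hD⟩
  rw [hD]
  simp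

end Kraus

/-! ### Norms of channels and their ampliations -/

section Norm

variable {κ ι : Type*} [Fintype κ] [DecidableEq κ] [Fintype ι] [DecidableEq ι]

theorem norm_submatrix_equiv_le (e : ι ≃ κ) (A : Matrix κ κ ℂ) : ‖A.submatrix e e‖ ≤ ‖A‖ := by
  let φ : Matrix κ κ ℂ →⋆ₙₐ[ℂ] Matrix ι ι ℂ :=
    { toFun := fun A => A.submatrix e e
      map_smul' := fun _ _ => rfl
      map_zero' := rfl
      map_add' := fun _ _ => rfl
      map_mul' := fun A B => (Matrix.submatrix_mul_equiv A B e e e).symm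
      map_star' := fun _ => rfl }
  exact NonUnitalStarAlgHom.norm_apply_le φ A

theorem norm_submatrix_equiv (e : ι ≃ κ) (A : Matrix κ κ ℂ) : ‖A.submatrix e e‖ = ‖A‖ := by
  refine le_antisymm (norm_submatrix_equiv_le e A) ?_
  simpa using norm_submatrix_equiv_le e.symm (A.submatrix e e)

theorem norm_one_kronecker_le {σ : Type*} [Fintype σ] [DecidableEq σ] (X : Matrix κ κ ℂ) :
    ‖Matrix.kroneckerMap (· * ·) (1 : Matrix σ σ ℂ) X‖ ≤ ‖X‖ := by
  let φ : Matrix κ κ ℂ →⋆ₙₐ[ℂ] Matrix (σ × κ) (σ × κ) ℂ :=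
    { toFun := fun X => Matrix.kroneckerMap (· * ·) (1 : Matrix σ σ ℂ) X
      map_smul' := fun c X => Matrix.kronecker_smul c _ X
      map_zero' := Matrix.kronecker_zero _
      map_add' := fun X Y => Matrix.kronecker_add _ X Y
      map_mul' := fun X Y => by simpa using Matrix.mul_kronecker_mul (1 : Matrix σ σ ℂ) 1 X Y
      map_star' := fun X => by
        simp [Matrix.star_eq_conjTranspose, Matrix.conjTranspose_kronecker] }
  exact NonUnitalStarAlgHom.norm_apply_le φ X

/-- Channels are contractions: with the Kraus operators stacked to an isometry `W`, a channel has
the form `X ↦ Wᴴ (1 ⊗ X) W`. -/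
theorem IsChannel.norm_apply_le {T : Matrix κ κ ℂ →ₗ[ℂ] Matrix ι ι ℂ} (hT : IsChannel T)
    (X : Matrix κ κ ℂ) : ‖T X‖ ≤ ‖X‖ := by
  obtain ⟨r, K, hK⟩ := hT.exists_kraus
  let W : Matrix (Fin r × κ) ι ℂ := Matrix.of fun a x => K a.1 a.2 x
  have hW : ∀ X, T X = W.conjTranspose *
      Matrix.kroneckerMap (· * ·) (1 : Matrix (Fin r) (Fin r) ℂ) X * W := by
    intro X
    rw [hK]
    ext x y
    simp [Matrix.sum_apply, Matrix.mul_apply, W, Fintype.sum_prod_type, Matrix.one_apply,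
      Finset.sum_mul]
  have h1 : ‖W‖ * ‖W‖ ≤ 1 := by
    rw [← Matrix.l2_opNorm_conjTranspose_mul_self]
    have := hW 1
    rw [Matrix.one_kronecker_one, Matrix.mul_one, hT.map_one] at this
    rw [← this]
    rw [← Matrix.diagonal_one, Matrix.l2_opNorm_diagonal]
    exact (pi_norm_le_iff_of_nonneg zero_le_one).mpr fun i => by simp
  rw [hW]
  calc _ ≤ ‖W.conjTranspose‖ *
        ‖Matrix.kroneckerMap (· * ·) (1 : Matrix (Fin r) (Fin r) ℂ) X‖ * ‖W‖ :=
        (Matrix.l2_opNorm_mul _ _).trans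
          (mul_le_mul_of_nonneg_right (Matrix.l2_opNorm_mul _ _) (norm_nonneg _))
    _ ≤ ‖W‖ * ‖X‖ * ‖W‖ := by
        rw [Matrix.l2_opNorm_conjTranspose]
        gcongr
        exact norm_one_kronecker_le X
    _ = (‖W‖ * ‖W‖) * ‖X‖ := by ring
    _ ≤ 1 * ‖X‖ := by gcongr
    _ = ‖X‖ := one_mul _
end Norm

/-! ### Bounds on the cb-norm and on the coding error -/

theorem ampliation_sum {κ ι σ : Type*} (s : Finset σ)
    (T : σ → Matrix κ κ ℂ →ₗ[ℂ] Matrix ι ι ℂ) (n : ℕ)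
    (A : Matrix (κ × Fin n) (κ × Fin n) ℂ) :
    ampliation (∑ k ∈ s, T k) n A = ∑ k ∈ s, ampliation (T k) n A := by
  ext x y
  rw [Matrix.sum_apply]
  simp [ampliation, LinearMap.sum_apply, Matrix.sum_apply]

section CBBound

variable {κ ι : Type*} [Fintype κ] [DecidableEq κ] [Fintype ι] [DecidableEq ι]

/-- `‖T‖_cb ≤ c`, as a real inequality for each ampliation; it is used for `c ≥ 0`. -/
def CBBound (T : Matrix κ κ ℂ →ₗ[ℂ] Matrix ι ι ℂ) (c : ℝ) : Prop :=
  ∀ (n : ℕ) (A : Matrix (κ × Fin n) (κ × Fin n) ℂ), ‖ampliation T n A‖ ≤ c * ‖A‖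

theorem enorm_ampliation_le_cbNorm (T : Matrix κ κ ℂ →ₗ[ℂ] Matrix ι ι ℂ) {n : ℕ}
    {A : Matrix (κ × Fin n) (κ × Fin n) ℂ} (hA : ‖A‖ ≤ 1) : ‖ampliation T n A‖ₑ ≤ cbNorm T :=
  (le_iSup (fun _ : ‖A‖ ≤ 1 => ‖ampliation T n A‖ₑ) hA).trans
    ((le_iSup (fun A : Matrix (κ × Fin n) (κ × Fin n) ℂ =>
      ⨆ _ : ‖A‖ ≤ 1, ‖ampliation T n A‖ₑ) A).trans
    (le_iSup (fun n => ⨆ (A : Matrix (κ × Fin n) (κ × Fin n) ℂ) (_ : ‖A‖ ≤ 1),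
      ‖ampliation T n A‖ₑ) n))

theorem cbNorm_le_ofReal_iff {T : Matrix κ κ ℂ →ₗ[ℂ] Matrix ι ι ℂ} {c : ℝ} (hc : 0 ≤ c) :
    cbNorm T ≤ ENNReal.ofReal c ↔ CBBound T c := by
  constructor
  · intro h n A
    have h1 : ∀ B : Matrix (κ × Fin n) (κ × Fin n) ℂ, ‖B‖ ≤ 1 → ‖ampliation T n B‖ ≤ c := by
      intro B hB
      have : ‖ampliation T n B‖ₑ ≤ ENNReal.ofReal c :=
        (enorm_ampliation_le_cbNorm T hB).trans h
      rwa [← ofReal_norm, ENNReal.ofReal_le_ofReal_iff hc] at this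
    rcases eq_or_ne A 0 with rfl | hA
    · simp
    · have hA' : 0 < ‖A‖ := norm_pos_iff.mpr hA
      have h2 := h1 (((‖A‖⁻¹ : ℝ) : ℂ) • A) (by rw [norm_smul]; simp [hA'.ne'])
      rw [map_smul, norm_smul] at h2
      simp only [Complex.norm_real, norm_inv, norm_norm] at h2
      rwa [inv_mul_le_iff₀ hA', mul_comm] at h2
  · intro h
    refine iSup_le fun n => iSup_le fun A => iSup_le fun hA => ?_
    rw [← ofReal_norm]
    exact ENNReal.ofReal_le_ofReal ((h n A).trans (mul_le_of_le_one_right hc hA))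

/-- A cb-norm bound controls `T ⊗ id` on `ℂ^κ ⊗ ℂ^J` for every finite index type `J`. -/
theorem CBBound.norm_blocks_le {T : Matrix κ κ ℂ →ₗ[ℂ] Matrix ι ι ℂ} {c : ℝ} (h : CBBound T c)
    {J : Type*} [Fintype J] [DecidableEq J] (A : Matrix (κ × J) (κ × J) ℂ) :
    ‖(Matrix.of fun x y => T (Matrix.of fun a b => A (a, x.2) (b, y.2)) x.1 y.1 :
      Matrix (ι × J) (ι × J) ℂ)‖ ≤ c * ‖A‖ := by
  let e := Fintype.equivFin J
  let f := (Equiv.refl κ).prodCongr e.symm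
  let g := (Equiv.refl ι).prodCongr e
  have h1 := h _ (A.submatrix f f)
  rw [norm_submatrix_equiv, ← norm_submatrix_equiv g] at h1
  convert h1 using 2
  ext x y
  simp [ampliation, f, g]

theorem CBBound.comp {τ : Type*} [Fintype τ] [DecidableEq τ]
    {S : Matrix ι ι ℂ →ₗ[ℂ] Matrix τ τ ℂ} {T : Matrix κ κ ℂ →ₗ[ℂ] Matrix ι ι ℂ} {c d : ℝ}
    (hS : CBBound S c) (hc : 0 ≤ c) (hT : CBBound T d) : CBBound (S ∘ₗ T) (c * d) := fun n A =>
  calc ‖ampliation S n (ampliation T n A)‖ ≤ c * ‖ampliation T n A‖ := hS n _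
    _ ≤ c * (d * ‖A‖) := mul_le_mul_of_nonneg_left (hT n A) hc
    _ = c * d * ‖A‖ := (mul_assoc _ _ _).symm

theorem CBBound.sum {σ : Type*} {s : Finset σ} {T : σ → Matrix κ κ ℂ →ₗ[ℂ] Matrix ι ι ℂ}
    {c : σ → ℝ} (h : ∀ k ∈ s, CBBound (T k) (c k)) : CBBound (∑ k ∈ s, T k) (∑ k ∈ s, c k) := by
  intro n A
  rw [ampliation_sum, Finset.sum_mul]
  exact norm_sum_le_of_le _ fun k hk => h k hk n A

theorem CBBound.mono {T : Matrix κ κ ℂ →ₗ[ℂ] Matrix ι ι ℂ} {c d : ℝ} (h : CBBound T c)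
    (hcd : c ≤ d) : CBBound T d := fun n A =>
  (h n A).trans (mul_le_mul_of_nonneg_right hcd (norm_nonneg _))

theorem IsChannel.cbBound {T : Matrix κ κ ℂ →ₗ[ℂ] Matrix ι ι ℂ} (hT : IsChannel T) :
    CBBound T 1 := fun n A => by
  rw [one_mul]
  exact (hT.ampliation n).norm_apply_le A

theorem cbNorm_comp_comp_le {κ' ι' : Type*} [Fintype κ'] [DecidableEq κ'] [Fintype ι']
    [DecidableEq ι'] (T : Matrix κ κ ℂ →ₗ[ℂ] Matrix ι ι ℂ)
    {E : Matrix ι ι ℂ →ₗ[ℂ] Matrix ι' ι' ℂ} {D : Matrix κ' κ' ℂ →ₗ[ℂ] Matrix κ κ ℂ}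
    (hE : IsChannel E) (hD : IsChannel D) : cbNorm (E ∘ₗ T ∘ₗ D) ≤ cbNorm T := by
  refine iSup_le fun n => iSup_le fun A => iSup_le fun hA => ?_
  have h1 : ampliation (E ∘ₗ T ∘ₗ D) n A = ampliation E n (ampliation T n (ampliation D n A)) := rfl
  have h2 := enorm_ampliation_le_cbNorm T (((hD.ampliation n).norm_apply_le A).trans hA)
  refine le_trans ?_ h2
  rw [h1, ← ofReal_norm, ← ofReal_norm]
  exact ENNReal.ofReal_le_ofReal ((hE.ampliation n).norm_apply_le _)

theorem exists_of_codingError_lt {T : Matrix κ κ ℂ →ₗ[ℂ] Matrix ι ι ℂ} {M : ℕ} {ε : ℝ} (hε : 0 ≤ ε)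
    (h : codingError T M < ENNReal.ofReal ε) :
    ∃ (E : Matrix ι ι ℂ →ₗ[ℂ] Matrix (Fin M) (Fin M) ℂ)
      (D : Matrix (Fin M) (Fin M) ℂ →ₗ[ℂ] Matrix κ κ ℂ), IsChannel E ∧ IsChannel D ∧
      CBBound (E ∘ₗ T ∘ₗ D - LinearMap.id) ε := by
  simp only [codingError, iInf_lt_iff] at h
  obtain ⟨E, D, hE, hD, h⟩ := h
  exact ⟨E, D, hE, hD, (cbNorm_le_ofReal_iff hε).mp h.le⟩

theorem codingError_le_of_cbBound {T : Matrix κ κ ℂ →ₗ[ℂ] Matrix ι ι ℂ} {M : ℕ} {ε : ℝ}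
    (hε : 0 ≤ ε) {E : Matrix ι ι ℂ →ₗ[ℂ] Matrix (Fin M) (Fin M) ℂ}
    {D : Matrix (Fin M) (Fin M) ℂ →ₗ[ℂ] Matrix κ κ ℂ} (hE : IsChannel E) (hD : IsChannel D)
    (h : CBBound (E ∘ₗ T ∘ₗ D - LinearMap.id) ε) : codingError T M ≤ ENNReal.ofReal ε :=
  (iInf_le_of_le E (iInf_le_of_le D (iInf_le_of_le hE (iInf_le_of_le hD le_rfl)))).trans
    ((cbNorm_le_ofReal_iff hε).mpr h)

/-- Codes for a channel that is simulated by `T` give codes for `T`. -/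
theorem codingError_le_codingError_comp {κ' ι' : Type*} [Fintype κ'] [DecidableEq κ'] [Fintype ι']
    [DecidableEq ι'] (T : Matrix κ κ ℂ →ₗ[ℂ] Matrix ι ι ℂ)
    {E : Matrix ι ι ℂ →ₗ[ℂ] Matrix ι' ι' ℂ} {D : Matrix κ' κ' ℂ →ₗ[ℂ] Matrix κ κ ℂ}
    (hE : IsChannel E) (hD : IsChannel D) (M : ℕ) :
    codingError T M ≤ codingError (E ∘ₗ T ∘ₗ D) M :=
  le_iInf fun E' => le_iInf fun D' => le_iInf fun hE' => le_iInf fun hD' =>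
    iInf_le_of_le (E' ∘ₗ E) (iInf_le_of_le (D ∘ₗ D') (iInf_le_of_le (hE'.comp hE)
      (iInf_le_of_le (hD.comp hD') le_rfl)))

theorem posSemidef_one_sub_of_isIdempotentElem {P : Matrix ι ι ℂ} (hP : P * P = P)
    (hP' : P.conjTranspose = P) : (1 - P).PosSemidef := by
  have : 1 - P = (1 - P).conjTranspose * (1 - P) := by
    simp [hP', Matrix.mul_sub, Matrix.sub_mul, hP]
  rw [this]
  exact Matrix.posSemidef_conjTranspose_mul_self _

/-- A smaller system is embedded in a larger one as a subspace, and the decoding is completed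
arbitrarily on the orthogonal complement. -/
theorem codingError_mono (T : Matrix κ κ ℂ →ₗ[ℂ] Matrix ι ι ℂ) {M N : ℕ} (hM : 0 < M)
    (hMN : M ≤ N) : codingError T M ≤ codingError T N := by
  let V : Matrix (Fin N) (Fin M) ℂ := Matrix.of fun i j => if i = Fin.castLE hMN j then 1 else 0
  have hV : V.conjTranspose * V = 1 := by
    ext i j
    simp [Matrix.mul_apply, V, Matrix.one_apply, eq_comm]
  have hP : V * V.conjTranspose * (V * V.conjTranspose) = V * V.conjTranspose := by
    rw [Matrix.mul_assoc, ← Matrix.mul_assoc V.conjTranspose, hV, Matrix.one_mul]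
  obtain ⟨D, hD, hD'⟩ := exists_channel_of_subunital (fun _ : Unit => V.conjTranspose)
    (by simpa using posSemidef_one_sub_of_isIdempotentElem hP (by simp)) (⟨0, hM⟩ : Fin M)
  have hE := isChannel_conjMap hV
  have hED : conjMap V ∘ₗ D = LinearMap.id := by
    refine LinearMap.ext fun X => ?_
    have h1 : V.conjTranspose * (V * X * V.conjTranspose) * V = X := by
      rw [← Matrix.mul_assoc, ← Matrix.mul_assoc, hV, Matrix.one_mul, Matrix.mul_assoc, hV,
        Matrix.mul_one]
    have h2 : V.conjTranspose * (V * V.conjTranspose) * V = 1 := by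
      rw [← Matrix.mul_assoc, hV, Matrix.one_mul, hV]
    simp [conjMap_apply, hD', Matrix.mul_add, Matrix.add_mul, Matrix.mul_sub, Matrix.sub_mul, h1,
      h2, hV]
  refine le_iInf fun E' => le_iInf fun D' => le_iInf fun hE' => le_iInf fun hD' => ?_
  refine iInf_le_of_le (conjMap V ∘ₗ E') (iInf_le_of_le (D' ∘ₗ D) (iInf_le_of_le (hE.comp hE')
    (iInf_le_of_le (hD'.comp hD) ?_)))
  have : (conjMap V ∘ₗ E') ∘ₗ T ∘ₗ D' ∘ₗ D - LinearMap.id =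
      conjMap V ∘ₗ (E' ∘ₗ T ∘ₗ D' - LinearMap.id) ∘ₗ D := by
    rw [LinearMap.sub_comp, LinearMap.comp_sub, LinearMap.id_comp, hED]
    rfl
  rw [this]
  exact cbNorm_comp_comp_le _ hE hD

end CBBound

/-! ### Tensor products of maps -/

/-- The product operator `⊗ᵢ Xᵢ` on `⊗ᵢ ℂ^κ = ℂ^(J → κ)`. -/
noncomputable def prodMatrix {J κ κ' : Type*} [Fintype J] (X : J → Matrix κ κ' ℂ) :
    Matrix (J → κ) (J → κ') ℂ :=
  Matrix.of fun a b => ∏ i, X i (a i) (b i)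

theorem prodMatrix_apply {J κ κ' : Type*} [Fintype J] (X : J → Matrix κ κ' ℂ) (a : J → κ)
    (b : J → κ') : prodMatrix X a b = ∏ i, X i (a i) (b i) := rfl

theorem prodMatrix_mul {J κ κ' κ'' : Type*} [Fintype J] [DecidableEq J] [Fintype κ']
    (X : J → Matrix κ κ' ℂ) (Y : J → Matrix κ' κ'' ℂ) :
    prodMatrix X * prodMatrix Y = prodMatrix fun i => X i * Y i := by
  ext a b
  simp only [Matrix.mul_apply, prodMatrix_apply, ← Finset.prod_mul_distrib]
  rw [Finset.prod_univ_sum, Fintype.piFinset_univ]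

theorem prodMatrix_conjTranspose {J κ κ' : Type*} [Fintype J] (X : J → Matrix κ κ' ℂ) :
    (prodMatrix X).conjTranspose = prodMatrix fun i => (X i).conjTranspose := by
  ext a b
  simp [prodMatrix_apply, Matrix.conjTranspose_apply]

theorem prodMatrix_one {J κ : Type*} [Fintype J] [DecidableEq J] [DecidableEq κ] :
    prodMatrix (fun _ : J => (1 : Matrix κ κ ℂ)) = 1 := by
  ext a b
  simp [prodMatrix_apply, Matrix.one_apply, Fintype.prod_ite_zero, funext_iff]

theorem prodMatrix_single {J κ : Type*} [Fintype J] [DecidableEq κ] [DecidableEq (J → κ)]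
    (a b : J → κ) :
    prodMatrix (fun i => Matrix.single (a i) (b i) (1 : ℂ)) = Matrix.single a b 1 := by
  ext x y
  simp only [prodMatrix_apply, Matrix.single_apply, Fintype.prod_ite_zero, Finset.prod_const_one,
    funext_iff]
  exact if_congr forall_and rfl rfl

theorem linearMap_ext_single {κ N : Type*} [Fintype κ] [DecidableEq κ] [AddCommMonoid N]
    [Module ℂ N] {S T : Matrix κ κ ℂ →ₗ[ℂ] N}
    (h : ∀ a b, S (Matrix.single a b 1) = T (Matrix.single a b 1)) : S = T := by
  refine Matrix.ext_linearMap ℂ fun a b => LinearMap.ext_ring ?_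
  simpa using h a b

/-- A linear map on a tensor product is determined by its values on product operators. -/
theorem linearMap_ext_prodMatrix {J κ N : Type*} [Fintype J] [DecidableEq J] [Fintype κ]
    [DecidableEq κ] [AddCommMonoid N] [Module ℂ N] {S T : Matrix (J → κ) (J → κ) ℂ →ₗ[ℂ] N}
    (h : ∀ X : J → Matrix κ κ ℂ, S (prodMatrix X) = T (prodMatrix X)) : S = T :=
  linearMap_ext_single fun a b => by
    simpa only [prodMatrix_single] using h fun i => Matrix.single (a i) (b i) 1

/-- The tensor product `⊗ᵢ Φᵢ`, through its values on matrix units. -/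
noncomputable def piTensor {J κ ι : Type*} [Fintype J] [DecidableEq J] [Fintype κ] [DecidableEq κ]
    (Φ : J → Matrix κ κ ℂ →ₗ[ℂ] Matrix ι ι ℂ) :
    Matrix (J → κ) (J → κ) ℂ →ₗ[ℂ] Matrix (J → ι) (J → ι) ℂ where
  toFun A := Matrix.of fun x y =>
    ∑ a : J → κ, ∑ b : J → κ, A a b * ∏ i, Φ i (Matrix.single (a i) (b i) 1) (x i) (y i)
  map_add' A B := by
    ext x y
    simp [add_mul, Finset.sum_add_distrib]
  map_smul' c A := by
    ext x y
    simp [mul_assoc, Finset.mul_sum]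

theorem tensorPower_eq_piTensor {κ ι : Type*} [Fintype κ] [DecidableEq κ]
    (T : Matrix κ κ ℂ →ₗ[ℂ] Matrix ι ι ℂ) (n : ℕ) :
    tensorPower T n = piTensor fun _ : Fin n => T := rfl

section PiTensor

variable {J κ ι : Type*} [Fintype J] [DecidableEq J] [Fintype κ] [DecidableEq κ]

theorem piTensor_prodMatrix (Φ : J → Matrix κ κ ℂ →ₗ[ℂ] Matrix ι ι ℂ) (X : J → Matrix κ κ ℂ) :
    piTensor Φ (prodMatrix X) = prodMatrix fun i => Φ i (X i) := by
  ext x y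
  simp only [piTensor, LinearMap.coe_mk, AddHom.coe_mk, Matrix.of_apply, prodMatrix_apply]
  simp_rw [apply_eq_sum_single (Φ _) (X _), Finset.prod_univ_sum, Fintype.piFinset_univ,
    ← Finset.prod_mul_distrib]

theorem piTensor_one {Φ : J → Matrix κ κ ℂ →ₗ[ℂ] Matrix ι ι ℂ} [DecidableEq ι]
    (h : ∀ i, Φ i 1 = 1) : piTensor Φ 1 = 1 := by
  rw [← prodMatrix_one, piTensor_prodMatrix]
  simp [h, prodMatrix_one]

theorem piTensor_id :
    piTensor (fun _ : J => (LinearMap.id : Matrix κ κ ℂ →ₗ[ℂ] Matrix κ κ ℂ)) = LinearMap.id :=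
  linearMap_ext_prodMatrix fun X => by simp [piTensor_prodMatrix]

theorem piTensor_comp [Fintype ι] [DecidableEq ι] {τ : Type*}
    (Ψ : J → Matrix ι ι ℂ →ₗ[ℂ] Matrix τ τ ℂ) (Φ : J → Matrix κ κ ℂ →ₗ[ℂ] Matrix ι ι ℂ) :
    piTensor Ψ ∘ₗ piTensor Φ = piTensor fun i => Ψ i ∘ₗ Φ i :=
  linearMap_ext_prodMatrix fun X => by simp [piTensor_prodMatrix]

/-- Binomial expansion of `(⊗ᵢ T) = ⊗ᵢ ((T - id) + id)`. -/
theorem piTensor_eq_sum_powerset (T : Matrix κ κ ℂ →ₗ[ℂ] Matrix κ κ ℂ) :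
    piTensor (fun _ : J => T) = ∑ S : Finset J,
      piTensor fun i => if i ∈ S then T - LinearMap.id else LinearMap.id := by
  refine linearMap_ext_prodMatrix fun X => ?_
  rw [LinearMap.sum_apply]
  ext x y
  simp only [piTensor_prodMatrix, Matrix.sum_apply, prodMatrix_apply]
  have h : ∀ i, T (X i) (x i) (y i) =
      (T - LinearMap.id : Matrix κ κ ℂ →ₗ[ℂ] Matrix κ κ ℂ) (X i) (x i) (y i) + X i (x i) (y i) := by
    intro i
    simp
  simp_rw [h]
  rw [Finset.prod_add, Finset.powerset_univ]
  refine Finset.sum_congr rfl fun S _ => ?_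
  rw [← Finset.prod_sdiff (Finset.subset_univ S), mul_comm]
  congr 1
  · exact Finset.prod_congr rfl fun i hi => by simp [(Finset.mem_sdiff.mp hi).2]
  · exact Finset.prod_congr rfl fun i hi => by simp [hi]

theorem isChannel_piTensor [Fintype ι] [DecidableEq ι] {T : Matrix κ κ ℂ →ₗ[ℂ] Matrix ι ι ℂ}
    (hT : IsChannel T) : IsChannel (piTensor fun _ : J => T) := by
  obtain ⟨r, K, hK⟩ := hT.exists_kraus
  have h : piTensor (fun _ : J => T) =
      krausMap fun k : J → Fin r => prodMatrix fun i => K (k i) := by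
    refine linearMap_ext_prodMatrix fun X => ?_
    change _ = ∑ k : J → Fin r, _
    simp only [piTensor_prodMatrix, prodMatrix_conjTranspose, prodMatrix_mul, hK]
    ext x y
    simp only [prodMatrix_apply, Matrix.sum_apply]
    rw [Finset.prod_univ_sum, Fintype.piFinset_univ]
  exact isChannel_of_kraus _ (fun X => by rw [h]; rfl) (piTensor_one fun _ => hT.map_one)

/-- A map acting on the single site `i` acts on the block of `Y` in which the other coordinates are
held fixed; hence it is an ampliation up to reindexing. -/
theorem piTensor_single_site (i : J) (Δ : Matrix κ κ ℂ →ₗ[ℂ] Matrix κ κ ℂ)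
    (Y : Matrix (J → κ) (J → κ) ℂ) (x y : J → κ) :
    piTensor (fun j => if j = i then Δ else LinearMap.id) Y x y =
      Δ (Matrix.of fun a b => Y (Function.update x i a) (Function.update y i b)) (x i) (y i) := by
  let F : Matrix (J → κ) (J → κ) ℂ →ₗ[ℂ] ℂ :=
    { toFun := fun Y =>
        Δ (Matrix.of fun a b => Y (Function.update x i a) (Function.update y i b)) (x i) (y i)
      map_add' := fun A B => by
        rw [← Matrix.add_apply, ← map_add]; rfl
      map_smul' := fun c A => by
        rw [RingHom.id_apply, ← Matrix.smul_apply, ← map_smul]; rfl }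
  let G : Matrix (J → κ) (J → κ) ℂ →ₗ[ℂ] ℂ :=
    Matrix.entryLinearMap ℂ ℂ x y ∘ₗ piTensor fun j => if j = i then Δ else LinearMap.id
  suffices G = F from LinearMap.congr_fun this Y
  refine linearMap_ext_prodMatrix fun X => ?_
  have h1 : (Matrix.of fun a b => prodMatrix X (Function.update x i a) (Function.update y i b)) =
      (∏ j ∈ Finset.univ.erase i, X j (x j) (y j)) • X i := by
    ext a b
    simp only [Matrix.of_apply, prodMatrix_apply, Matrix.smul_apply, smul_eq_mul]
    rw [← Finset.prod_erase_mul _ _ (Finset.mem_univ i)]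
    congr 1
    · exact Finset.prod_congr rfl fun j hj => by simp [Finset.ne_of_mem_erase hj]
    · simp
  change piTensor _ (prodMatrix X) x y = Δ _ (x i) (y i)
  rw [h1, map_smul, Matrix.smul_apply, smul_eq_mul, piTensor_prodMatrix, prodMatrix_apply,
    ← Finset.prod_erase_mul _ _ (Finset.mem_univ i)]
  congr 1
  · exact Finset.prod_congr rfl fun j hj => by simp [Finset.ne_of_mem_erase hj]
  · simp

theorem cbBound_piTensor_single_site (i : J) {Δ : Matrix κ κ ℂ →ₗ[ℂ] Matrix κ κ ℂ} {c : ℝ}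
    (h : CBBound Δ c) : CBBound (piTensor fun j => if j = i then Δ else LinearMap.id) c := by
  intro n A
  let f : (J → κ) × Fin n ≃ κ × (({j // j ≠ i} → κ) × Fin n) :=
    ((Equiv.funSplitAt i κ).prodCongr (Equiv.refl _)).trans (Equiv.prodAssoc _ _ _)
  have h1 := h.norm_blocks_le (A.submatrix f.symm f.symm)
  rw [norm_submatrix_equiv, ← norm_submatrix_equiv f] at h1
  have hf : ∀ a x, f.symm (a, (f x).2) = (Function.update x.1 i a, x.2) := by
    intro a x
    rw [Equiv.symm_apply_eq]
    refine Prod.ext ?_ (Prod.ext (funext fun j => ?_) rfl)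
    · simp [f]
    · simp [f, j.2]
  convert h1 using 2
  ext x y
  refine (piTensor_single_site i Δ _ x.1 y.1).trans ?_
  simp only [Matrix.submatrix_apply, Matrix.of_apply, hf]
  rfl

/-- Tensoring `Δ` on the sites in `S` multiplies the cb-norms. -/
theorem cbBound_piTensor_ite {Δ : Matrix κ κ ℂ →ₗ[ℂ] Matrix κ κ ℂ} {c : ℝ} (hc : 0 ≤ c)
    (h : CBBound Δ c) (S : Finset J) :
    CBBound (piTensor fun j => if j ∈ S then Δ else LinearMap.id) (c ^ S.card) := by
  induction S using Finset.induction_on with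
  | empty => simpa [piTensor_id] using (isChannel_id (κ := J → κ)).cbBound
  | insert i S hi ih =>
    have h1 := (cbBound_piTensor_single_site i h).comp hc ih
    rw [piTensor_comp, ← pow_succ', ← Finset.card_insert_of_notMem hi] at h1
    convert h1 using 3 with j
    rcases eq_or_ne j i with rfl | hj
    · simp [hi]
    · simp [hj]

end PiTensor

/-- The Kraus operators of `X ↦ X ⊗ 1` for a splitting `a ↦ (p a, s a)` of the basis. -/
noncomputable def discardKraus {α β γ : Type*} [DecidableEq α] [DecidableEq γ] (p : β → α)
    (s : β → γ) (c : γ) : Matrix α β ℂ :=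
  Matrix.of fun q a => if q = p a then if c = s a then 1 else 0 else 0

theorem krausMap_discardKraus_apply {α β γ : Type*} [Fintype α] [DecidableEq α] [Fintype γ]
    [DecidableEq γ] (p : β → α) (s : β → γ) (Y : Matrix α α ℂ) (a b : β) :
    krausMap (discardKraus p s) Y a b = if s a = s b then Y (p a) (p b) else 0 := by
  simp only [krausMap, discardKraus, LinearMap.coe_mk, AddHom.coe_mk, Matrix.sum_apply,
    Matrix.mul_apply, Matrix.conjTranspose_apply, Matrix.of_apply, apply_ite star, star_one,
    star_zero, ite_mul,
    one_mul, zero_mul, mul_ite, mul_one, mul_zero, Finset.sum_ite_eq',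
    Finset.mem_univ, if_true]
  exact if_congr eq_comm rfl rfl

/-- The power `(T^{⊗n})^{⊗m}` is simulated by `T^{⊗N}` for `N ≥ m n`: the remaining inputs are
discarded, and the remaining outputs are put in a fixed pure state. -/
theorem exists_simulation_tensorPower {κ ι : Type*} [Fintype κ] [DecidableEq κ] [Fintype ι]
    [DecidableEq ι] [Nonempty ι] {T : Matrix κ κ ℂ →ₗ[ℂ] Matrix ι ι ℂ} (hT : IsChannel T)
    {m n N : ℕ} (hN : m * n ≤ N) :
    ∃ (E : Matrix (Fin N → ι) (Fin N → ι) ℂ →ₗ[ℂ]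
          Matrix (Fin m → Fin n → ι) (Fin m → Fin n → ι) ℂ)
      (D : Matrix (Fin m → Fin n → κ) (Fin m → Fin n → κ) ℂ →ₗ[ℂ]
          Matrix (Fin N → κ) (Fin N → κ) ℂ),
      IsChannel E ∧ IsChannel D ∧
      E ∘ₗ tensorPower T N ∘ₗ D = tensorPower (tensorPower T n) m := by
  obtain ⟨o⟩ := ‹Nonempty ι›
  obtain ⟨r, rfl⟩ := Nat.exists_eq_add_of_le hN
  let e : (Fin m × Fin n) ⊕ Fin r ≃ Fin (m * n + r) :=
    (finProdFinEquiv.sumCongr (Equiv.refl _)).trans finSumFinEquiv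
  have hprod : ∀ g : Fin (m * n + r) → ℂ,
      ∏ k, g k = (∏ i, ∏ l, g (e (.inl (i, l)))) * ∏ s, g (e (.inr s)) := by
    intro g
    rw [← e.prod_comp, Fintype.prod_sum_type, Fintype.prod_prod_type]
  let ext : (Fin m → Fin n → ι) → (Fin (m * n + r) → ι) := fun x k =>
    Sum.elim (fun p => x p.1 p.2) (fun _ => o) (e.symm k)
  have hext : Function.Injective ext := by
    intro x y h
    funext i l
    simpa [ext] using congrFun h (e (.inl (i, l)))
  let V : Matrix (Fin (m * n + r) → ι) (Fin m → Fin n → ι) ℂ :=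
    Matrix.of fun z x => if z = ext x then 1 else 0
  have hV : V.conjTranspose * V = 1 := by
    ext x y
    simp [Matrix.mul_apply, V, Matrix.one_apply, hext.eq_iff, eq_comm]
  have hE : ∀ Y x y, conjMap V Y x y = Y (ext x) (ext y) := by
    intro Y x y
    simp [conjMap_apply, Matrix.mul_apply, V]
  let K : (Fin r → κ) → Matrix (Fin m → Fin n → κ) (Fin (m * n + r) → κ) ℂ :=
    discardKraus (fun a i l => a (e (.inl (i, l)))) fun a s => a (e (.inr s))
  have hD : ∀ X : Fin m → Fin n → Matrix κ κ ℂ,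
      krausMap K (prodMatrix fun i => prodMatrix (X i)) = prodMatrix fun k =>
        Sum.elim (fun p => X p.1 p.2) (fun _ => 1) (e.symm k) := by
    intro X
    ext a b
    rw [prodMatrix_apply, hprod]
    refine (krausMap_discardKraus_apply _ _ _ a b).trans ?_
    simp only [Equiv.symm_apply_apply, Sum.elim_inl, Sum.elim_inr, Matrix.one_apply,
      prodMatrix_apply, Fintype.prod_ite_zero, Finset.prod_const_one, mul_ite, mul_one, mul_zero]
    exact if_congr funext_iff rfl rfl
  have hD1 : krausMap K 1 = 1 := by
    have h1 : (fun k => Sum.elim (fun _ => (1 : Matrix κ κ ℂ)) (fun _ => 1) (e.symm k)) =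
        fun _ => 1 := by
      funext k
      rcases e.symm k with p | s <;> rfl
    have := hD fun _ _ => 1
    rw [h1, prodMatrix_one] at this
    rwa [prodMatrix_one, prodMatrix_one] at this
  clear_value K e
  refine ⟨conjMap V, krausMap K, isChannel_conjMap hV, isChannel_of_kraus _ (fun _ => rfl) hD1,
    linearMap_ext_single fun a b => ?_⟩
  simp only [← prodMatrix_single]
  ext x y
  simp only [LinearMap.comp_apply, hD, tensorPower_eq_piTensor, piTensor_prodMatrix, hE,
    prodMatrix_apply, hprod]
  simp [ext, hT.map_one]

/-! ### Reed–Solomon codes -/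

/-- A classical encoding of a message `x` and a key `y` into words over `α` with the two properties
that make the states `∑ y, |enc x y⟩` a quantum code correcting `t` errors: words that agree outside
`2t` positions come from the same pair, and any `2t` letters carry no information on `x` when `y` is
uniformly random. -/
structure IsErrorCorrecting {X Y J α : Type*} [Fintype J] [DecidableEq α] (t : ℕ)
    (enc : X → Y → J → α) : Prop where
  separated : ∀ x y x' y', (Finset.univ.filter fun i => enc x y i ≠ enc x' y' i).card ≤ 2 * t →
    x = x' ∧ y = y'
  hidden : ∀ x x' (S : Finset J), S.card ≤ 2 * t →
    ∃ σ : Equiv.Perm Y, ∀ y, ∀ i ∈ S, enc x y i = enc x' (σ y) i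

theorem IsErrorCorrecting.transport {X Y J α X' Y' α' : Type*} [Fintype J] [DecidableEq α]
    [DecidableEq α'] {t : ℕ} {enc : X → Y → J → α} (h : IsErrorCorrecting t enc) (eX : X' ≃ X)
    (eY : Y' ≃ Y) (eα : α ≃ α') :
    IsErrorCorrecting t fun x y i => eα (enc (eX x) (eY y) i) where
  separated x y x' y' hs := by
    simp only [ne_eq, EmbeddingLike.apply_eq_iff_eq] at hs
    obtain ⟨h1, h2⟩ := h.separated _ _ _ _ hs
    exact ⟨eX.injective h1, eY.injective h2⟩
  hidden x x' S hS := by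
    obtain ⟨σ, hσ⟩ := h.hidden (eX x) (eX x') S hS
    exact ⟨(eY.trans σ).trans eY.symm, fun y i hi => by simp [hσ (eY y) i hi]⟩

open Polynomial in
/-- The message and the key are the coefficients of high and of low degree of a polynomial of degree
less than `m - 2t`, which is evaluated at the `m` points `v i`. -/
theorem isErrorCorrecting_reedSolomon {F : Type*} [Field F] [DecidableEq F] {m t : ℕ}
    {v : Fin m → F} (hv : Function.Injective v) (hm : 4 * t ≤ m) :
    IsErrorCorrecting t fun (p : degreeLT F (m - 4 * t)) (r : degreeLT F (2 * t)) i =>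
      ((r : F[X]) + X ^ (2 * t) * (p : F[X])).eval (v i) where
  separated := by
    intro p r p' r' hs
    simp only [ne_eq] at hs
    have hp := mem_degreeLT.mp (p - p').2
    have hr := mem_degreeLT.mp (r - r').2
    set P : F[X] := ((p - p' : degreeLT F (m - 4 * t)) : F[X]) with hP
    set R : F[X] := ((r - r' : degreeLT F (2 * t)) : F[X]) with hR
    have h0 : R + X ^ (2 * t) * P = 0 := by
      refine eq_zero_of_degree_lt_of_eval_index_eq_zero
        (Finset.univ.filter fun i =>
          ((r : F[X]) + X ^ (2 * t) * (p : F[X])).eval (v i) =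
            ((r' : F[X]) + X ^ (2 * t) * (p' : F[X])).eval (v i)) hv.injOn ?_ ?_
      · have hcard := Finset.card_filter_add_card_filter_not (s := (Finset.univ : Finset (Fin m)))
          (fun i => ((r : F[X]) + X ^ (2 * t) * (p : F[X])).eval (v i) =
            ((r' : F[X]) + X ^ (2 * t) * (p' : F[X])).eval (v i))
        rw [Finset.card_univ, Fintype.card_fin] at hcard
        have h2t : 2 * t + (m - 4 * t) ≤ (Finset.univ.filter fun i =>
          ((r : F[X]) + X ^ (2 * t) * (p : F[X])).eval (v i) =
            ((r' : F[X]) + X ^ (2 * t) * (p' : F[X])).eval (v i)).card := by omega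
        refine lt_of_lt_of_le ?_ (Nat.cast_le.mpr h2t)
        rcases eq_or_ne P 0 with h | h
        · rw [h, mul_zero, add_zero]
          exact hr.trans_le (Nat.cast_le.mpr (by omega))
        · refine (degree_add_le _ _).trans_lt (max_lt
            (hr.trans_le (Nat.cast_le.mpr (by omega))) ?_)
          rw [degree_mul, degree_X_pow, degree_eq_natDegree h] at *
          exact_mod_cast Nat.add_lt_add_left (by exact_mod_cast hp) _
      · intro i hi
        have := (Finset.mem_filter.mp hi).2
        simp only [eval_add, eval_mul] at this
        simp only [hP, hR, Submodule.coe_sub, eval_add, eval_mul, eval_sub]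
        linear_combination this
    have hP0 : P = 0 := by
      by_contra h
      have h1 : R = -(X ^ (2 * t) * P) := eq_neg_of_add_eq_zero_left h0
      rw [h1, degree_neg, degree_mul, degree_X_pow, degree_eq_natDegree h] at hr
      have : 2 * t + P.natDegree < 2 * t := by exact_mod_cast hr
      omega
    have hR0 : R = 0 := by simpa [hP0] using h0
    exact ⟨sub_eq_zero.mp (Subtype.ext hP0), sub_eq_zero.mp (Subtype.ext hR0)⟩
  hidden := by
    intro p p' S hS
    let w : F[X] := Lagrange.interpolate S v fun i =>
      (X ^ (2 * t) * ((p : F[X]) - (p' : F[X]))).eval (v i)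
    have hw : w ∈ degreeLT F (2 * t) := mem_degreeLT.mpr
      ((Lagrange.degree_interpolate_lt _ hv.injOn).trans_le (Nat.cast_le.mpr hS))
    refine ⟨Equiv.addRight ⟨w, hw⟩, fun r i hi => ?_⟩
    have : w.eval (v i) = (X ^ (2 * t) * ((p : F[X]) - (p' : F[X]))).eval (v i) :=
      Lagrange.eval_interpolate_at_node _ hv.injOn hi
    simp only [eval_mul, eval_sub] at this
    simp only [Equiv.coe_addRight, Submodule.coe_add, eval_add, eval_mul, this]
    ring

/-- Over an alphabet of `2 ^ l ≥ m` letters there are `t`-error-correcting codes of length `m` for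
`m - 4t` message letters. -/
theorem exists_isErrorCorrecting {l m t : ℕ} (hl : l ≠ 0) (hml : m ≤ 2 ^ l) (hm : 4 * t ≤ m) :
    ∃ enc : Fin ((2 ^ l) ^ (m - 4 * t)) → (Fin (2 * t) → Fin (2 ^ l)) → Fin m → Fin (2 ^ l),
      IsErrorCorrecting t enc := by
  classical
  let F := GaloisField 2 l
  have hF : Nat.card F = 2 ^ l := GaloisField.card 2 l hl
  let e : F ≃ Fin (2 ^ l) := Finite.equivFinOfCardEq hF
  have hv : Function.Injective (e.symm ∘ Fin.castLE hml) :=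
    e.symm.injective.comp (Fin.castLE_injective hml)
  let eX : Polynomial.degreeLT F (m - 4 * t) ≃ Fin ((2 ^ l) ^ (m - 4 * t)) :=
    ((Polynomial.degreeLTEquiv F _).toEquiv.trans ((Equiv.refl _).arrowCongr e)).trans
      finFunctionFinEquiv
  let eY : Polynomial.degreeLT F (2 * t) ≃ (Fin (2 * t) → Fin (2 ^ l)) :=
    (Polynomial.degreeLTEquiv F _).toEquiv.trans ((Equiv.refl _).arrowCongr e)
  exact ⟨_, (isErrorCorrecting_reedSolomon hv hm).transport eX.symm eY.symm e⟩

/-! ### Quantum error correction -/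

/-- A positive semidefinite matrix `G` has a generalized inverse square root `B`, obtained by
inverting the nonzero eigenvalues. -/
theorem exists_inverse_sqrt {I : Type*} [Fintype I] [DecidableEq I] {G : Matrix I I ℂ}
    (hG : G.PosSemidef) : ∃ B : Matrix I I ℂ,
      G * (B.conjTranspose * B) * G = G ∧ B * G * (B.conjTranspose * B) = B := by
  let U : Matrix I I ℂ := hG.1.eigenvectorUnitary
  let l : I → ℝ := hG.1.eigenvalues
  -- An eigenvalue `0` gives `s i = 0`, since `0⁻¹ = 0`.
  let s : I → ℝ := fun i => (√(l i))⁻¹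
  have hU : U.conjTranspose * U = 1 := Unitary.coe_star_mul_self hG.1.eigenvectorUnitary
  have hU' : ∀ Z : Matrix I I ℂ, U.conjTranspose * (U * Z) = Z := fun Z => by
    rw [← Matrix.mul_assoc, hU, Matrix.one_mul]
  have hGU : G = U * (Matrix.diagonal (fun i => (l i : ℂ)) * U.conjTranspose) := by
    have := hG.1.spectral_theorem
    rw [Unitary.conjStarAlgAut_apply] at this
    rw [← Matrix.mul_assoc]
    exact this
  have hls : ∀ i, l i * (s i * s i) * l i = l i ∧ s i * l i * (s i * s i) = s i := by
    intro i
    have h0 : 0 ≤ l i := hG.eigenvalues_nonneg i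
    rcases h0.eq_or_lt with h | h
    · simp [s, ← h]
    · have h1 := Real.mul_self_sqrt h0
      have h2 : √(l i) ≠ 0 := (Real.sqrt_pos.mpr h).ne'
      constructor <;> simp only [s] <;> field_simp <;> rw [sq, h1]
  have hs : (Matrix.diagonal fun i => (s i : ℂ)).conjTranspose =
      Matrix.diagonal fun i => (s i : ℂ) := by
    rw [Matrix.diagonal_conjTranspose]
    congr 1
    funext i
    exact Complex.conj_ofReal _
  refine ⟨Matrix.diagonal (fun i => (s i : ℂ)) * U.conjTranspose, ?_, ?_⟩
  · rw [hGU]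
    simp only [Matrix.conjTranspose_mul, Matrix.conjTranspose_conjTranspose, hs, Matrix.mul_assoc,
      hU']
    congr 1
    simp only [← Matrix.mul_assoc, Matrix.diagonal_mul_diagonal]
    congr 2
    funext i
    have := (hls i).1
    simp only [mul_assoc] at this ⊢
    exact_mod_cast this
  · rw [hGU]
    simp only [Matrix.conjTranspose_mul, Matrix.conjTranspose_conjTranspose, hs, Matrix.mul_assoc,
      hU']
    simp only [← Matrix.mul_assoc, Matrix.diagonal_mul_diagonal]
    congr 2
    funext i
    have := (hls i).2
    simp only [mul_assoc] at this ⊢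
    exact_mod_cast this

/-- The Knill–Laflamme construction of a decoder.  The operators `W i` are the errors composed with
the encoding isometry; with a generalized inverse square root `B` of their Gram matrix `G`,
the operators `K k = ∑ B k i • (W i)ᴴ` are the Kraus operators of the decoder: they satisfy
`K k * W j = (B * G) k j • 1`, and `∑ Kᴴ K` is the projection onto the span of the ranges of the
`W i`, so that they can be completed to a channel by `exists_channel_of_subunital`. -/
theorem exists_decoder {I κ μ : Type*} [Fintype I] [DecidableEq I] [Fintype κ] [DecidableEq κ]
    [Fintype μ] [DecidableEq μ] [Nonempty μ] (W : I → Matrix κ μ ℂ) (G : Matrix I I ℂ)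
    (hG : ∀ i j, (W i).conjTranspose * W j = G i j • (1 : Matrix μ μ ℂ)) :
    ∃ D : Matrix μ μ ℂ →ₗ[ℂ] Matrix κ κ ℂ, IsChannel D ∧
      ∀ i j X, (W i).conjTranspose * D X * W j = G i j • X := by
  obtain ⟨o⟩ := ‹Nonempty μ›
  have hGpos : G.PosSemidef := by
    let M : Matrix κ I ℂ := Matrix.of fun a i => W i a o
    have : G = M.conjTranspose * M := by
      ext i j
      have := congrFun (congrFun (hG i j) o) o
      simp only [Matrix.mul_apply, Matrix.conjTranspose_apply, Matrix.smul_apply, Matrix.one_apply,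
        if_true, smul_eq_mul, mul_one] at this
      simp [Matrix.mul_apply, M, ← this]
    rw [this]
    exact Matrix.posSemidef_conjTranspose_mul_self _
  obtain ⟨B, hB1, hB2⟩ := exists_inverse_sqrt hGpos
  let K : I → Matrix μ κ ℂ := fun k => ∑ i, B k i • (W i).conjTranspose
  have hKW : ∀ k j, K k * W j = (B * G) k j • (1 : Matrix μ μ ℂ) := by
    intro k j
    simp only [K, Matrix.sum_mul, Matrix.smul_mul, hG, Matrix.mul_apply, Finset.sum_smul, smul_smul]
  have hWK : ∀ i k, (W i).conjTranspose * (K k).conjTranspose =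
      (B * G).conjTranspose i k • (1 : Matrix μ μ ℂ) := by
    intro i k
    rw [← Matrix.conjTranspose_mul, hKW, Matrix.conjTranspose_smul, Matrix.conjTranspose_one,
      Matrix.conjTranspose_apply]
  have hKK : ∀ k l, K k * (K l).conjTranspose =
      (B * G * B.conjTranspose) k l • (1 : Matrix μ μ ℂ) := by
    intro k l
    have : (K l).conjTranspose = ∑ j, star (B l j) • W j := by
      simp [K, Matrix.conjTranspose_sum]
    rw [this, Matrix.mul_sum, Matrix.mul_apply, Finset.sum_smul]
    exact Finset.sum_congr rfl fun j _ => by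
      rw [Matrix.mul_smul, hKW, smul_smul, Matrix.conjTranspose_apply, mul_comm]
  have hsum : ∀ k, ∑ l, (B * G * B.conjTranspose) k l • K l = K k := by
    intro k
    simp only [K, Finset.smul_sum, smul_smul]
    rw [Finset.sum_comm]
    refine Finset.sum_congr rfl fun i _ => ?_
    rw [← Finset.sum_smul, ← Matrix.mul_apply, Matrix.mul_assoc, hB2]
  have hP : (∑ k, (K k).conjTranspose * K k) * (∑ k, (K k).conjTranspose * K k) =
      ∑ k, (K k).conjTranspose * K k := by
    rw [Matrix.sum_mul]
    refine Finset.sum_congr rfl fun k _ => ?_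
    have h1 : (K k).conjTranspose * K k =
        ∑ l, (K k).conjTranspose * ((B * G * B.conjTranspose) k l • K l) := by
      rw [← Matrix.mul_sum, hsum]
    rw [Matrix.mul_sum]
    refine (Finset.sum_congr rfl fun l _ => ?_).trans h1.symm
    rw [Matrix.mul_assoc, ← Matrix.mul_assoc (K k), hKK, Matrix.smul_mul, Matrix.one_mul]
  have hPstar : (∑ k, (K k).conjTranspose * K k).conjTranspose =
      ∑ k, (K k).conjTranspose * K k := by
    simp [Matrix.conjTranspose_sum]
  obtain ⟨D, hD, hD'⟩ := exists_channel_of_subunital K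
    (posSemidef_one_sub_of_isIdempotentElem hP hPstar) o
  have key : ∀ i j (X : Matrix μ μ ℂ),
      (W i).conjTranspose * (∑ k, (K k).conjTranspose * X * K k) * W j = G i j • X := by
    intro i j X
    have h1 : (B * G).conjTranspose * (B * G) = G := by
      rw [Matrix.conjTranspose_mul, hGpos.1.eq, Matrix.mul_assoc, ← Matrix.mul_assoc _ B,
        ← Matrix.mul_assoc, hB1]
    conv_rhs => rw [← h1]
    rw [Matrix.mul_sum, Matrix.sum_mul, Matrix.mul_apply, Finset.sum_smul]
    refine Finset.sum_congr rfl fun k _ => ?_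
    calc (W i).conjTranspose * ((K k).conjTranspose * X * K k) * W j =
        ((W i).conjTranspose * (K k).conjTranspose) * X * (K k * W j) := by
          simp only [Matrix.mul_assoc]
      _ = _ := by
          rw [hWK, hKW, Matrix.smul_mul, Matrix.one_mul, Matrix.mul_smul, Matrix.mul_one, smul_smul,
            mul_comm]
  refine ⟨D, hD, fun i j X => ?_⟩
  have h1 := key i j 1
  simp only [Matrix.mul_one] at h1
  rw [hD', Matrix.mul_add, Matrix.add_mul, key, Matrix.mul_smul, Matrix.smul_mul, Matrix.mul_sub,
    Matrix.sub_mul, h1, Matrix.mul_one, hG, sub_self, smul_zero, add_zero]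

/-- The encoding `|x⟩ ↦ |Y|^(-1/2) ∑ y, |enc x y⟩`. -/
noncomputable def codeIsometry {J α μ Y : Type*} [Fintype J] [DecidableEq α] [Fintype Y]
    (enc : μ → Y → J → α) : Matrix (J → α) μ ℂ :=
  Matrix.of fun a x => (((√(Fintype.card Y))⁻¹ : ℝ) : ℂ) * ∑ y, if a = enc x y then 1 else 0

theorem codeIsometry_conj_apply {J α μ Y : Type*} [Fintype J] [DecidableEq J] [Fintype α]
    [DecidableEq α] [Fintype Y] (enc : μ → Y → J → α) (O : Matrix (J → α) (J → α) ℂ)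
    (x x' : μ) :
    ((codeIsometry enc).conjTranspose * O * codeIsometry enc) x x' =
      (Fintype.card Y : ℂ)⁻¹ * ∑ y, ∑ y', O (enc x y) (enc x' y') := by
  have hc : (((√(Fintype.card Y))⁻¹ : ℝ) : ℂ) * (((√(Fintype.card Y))⁻¹ : ℝ) : ℂ) =
      (Fintype.card Y : ℂ)⁻¹ := by
    rw [← Complex.ofReal_mul, ← mul_inv, Real.mul_self_sqrt (Nat.cast_nonneg _)]
    simp
  have hV : ∀ (g : (J → α) → ℂ) (x : μ), ∑ a, codeIsometry enc a x * g a =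
      (((√(Fintype.card Y))⁻¹ : ℝ) : ℂ) * ∑ y, g (enc x y) := by
    intro g x
    simp only [codeIsometry, Matrix.of_apply, mul_assoc, ← Finset.mul_sum, Finset.sum_mul]
    rw [Finset.sum_comm]
    simp
  have hstar : ∀ a x, star (codeIsometry enc a x) = codeIsometry enc a x := by
    intro a x
    simp [codeIsometry]
  simp only [Matrix.mul_apply, Matrix.conjTranspose_apply, hstar, hV]
  simp only [mul_comm _ (codeIsometry enc _ x'), hV]
  rw [← Finset.mul_sum, ← mul_assoc, hc, Finset.sum_comm]

section Code

variable {J α μ Y : Type*} [Fintype J] [DecidableEq J] [Fintype α] [DecidableEq α]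
  [DecidableEq μ] [Fintype Y]

/-- The Knill–Laflamme condition: the code does not see an operator on at most `2t` sites. -/
theorem IsErrorCorrecting.conj_prodMatrix {t : ℕ} {enc : μ → Y → J → α}
    (h : IsErrorCorrecting t enc) (o : μ) {S : Finset J} (hS : S.card ≤ 2 * t)
    {X : J → Matrix α α ℂ} (hX : ∀ i ∉ S, X i = 1) :
    (codeIsometry enc).conjTranspose * prodMatrix X * codeIsometry enc =
      ((Fintype.card Y : ℂ)⁻¹ * ∑ y, prodMatrix X (enc o y) (enc o y)) • (1 : Matrix μ μ ℂ) := by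
  classical
  have h0 : ∀ x y x' y', prodMatrix X (enc x y) (enc x' y') ≠ 0 → x = x' ∧ y = y' := by
    intro x y x' y' hne
    refine h.separated x y x' y' ((Finset.card_le_card fun i hi => ?_).trans hS)
    by_contra hiS
    have := Finset.prod_ne_zero_iff.mp hne i (Finset.mem_univ i)
    rw [hX i hiS, Matrix.one_apply_ne (Finset.mem_filter.mp hi).2] at this
    exact this rfl
  have hdiag : ∀ a : J → α, prodMatrix X a a = ∏ i ∈ S, X i (a i) (a i) := by
    intro a
    rw [prodMatrix_apply]
    refine (Finset.prod_subset (Finset.subset_univ S) fun i _ hi => ?_).symm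
    rw [hX i hi, Matrix.one_apply_eq]
  ext x x'
  rw [codeIsometry_conj_apply, Matrix.smul_apply, smul_eq_mul, mul_assoc]
  congr 1
  rcases eq_or_ne x x' with rfl | hx
  · rw [Matrix.one_apply_eq, mul_one]
    obtain ⟨σ, hσ⟩ := h.hidden o x S hS
    refine (Equiv.sum_comp σ _).symm.trans (Finset.sum_congr rfl fun y _ => ?_)
    rw [Finset.sum_eq_single (σ y)]
    · rw [hdiag, hdiag]
      exact Finset.prod_congr rfl fun i hi => by rw [hσ y i hi]
    · intro y' _ hy
      by_contra hne
      exact hy (h0 _ _ _ _ hne).2.symm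
    · simp
  · rw [Matrix.one_apply_ne hx, mul_zero]
    refine Finset.sum_eq_zero fun y _ => Finset.sum_eq_zero fun y' _ => ?_
    by_contra hne
    exact hx (h0 _ _ _ _ hne).1

theorem IsErrorCorrecting.codeIsometry_conjTranspose_mul [Nonempty Y] {t : ℕ} {enc : μ → Y → J → α}
    (h : IsErrorCorrecting t enc) :
    (codeIsometry enc).conjTranspose * codeIsometry enc = 1 := by
  rcases isEmpty_or_nonempty μ with hμ | ⟨⟨o⟩⟩
  · exact Subsingleton.elim _ _
  have := h.conj_prodMatrix o (S := ∅) (X := fun _ => 1) (by simp) (fun _ _ => rfl)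
  rw [prodMatrix_one, Matrix.mul_one] at this
  simpa using this

/-- The single-site error operators: the identity and the matrix units. -/
noncomputable def siteError {α : Type*} [DecidableEq α] : Option (α × α) → Matrix α α ℂ
  | none => 1
  | some p => Matrix.single p.1 p.2 1

/-- The coefficients of a linear map `Φ` in an expansion `Φ Z = ∑ φ (A, B) • Aᴴ Z B` over pairs of
single-site error operators; only pairs of matrix units are used. -/
noncomputable def siteCoeff {α : Type*} [DecidableEq α] (Φ : Matrix α α ℂ →ₗ[ℂ] Matrix α α ℂ) :
    Option (α × α) × Option (α × α) → ℂ
  | (some p, some q) => Φ (Matrix.single p.1 q.1 1) p.2 q.2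
  | _ => 0

theorem sum_siteCoeff (Φ : Matrix α α ℂ →ₗ[ℂ] Matrix α α ℂ) (Z : Matrix α α ℂ) :
    Φ Z = ∑ p, siteCoeff Φ p • ((siteError p.1).conjTranspose * Z * siteError p.2) := by
  simp only [Fintype.sum_prod_type, Fintype.sum_option, siteCoeff, zero_smul, zero_add,
    Finset.sum_const_zero, siteError]
  ext x y
  rw [apply_eq_sum_single]
  simp only [Matrix.sum_apply, Matrix.smul_apply, Matrix.conjTranspose_single, star_one,
    Matrix.single_mul_mul_single, one_mul, mul_one, Matrix.single_apply, smul_eq_mul]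
  refine Finset.sum_congr rfl fun a _ => ?_
  rw [Finset.sum_comm]
  refine Finset.sum_congr rfl fun b _ => ?_
  simp [ite_and, mul_comm]

/-- A tensor product of maps that are the identity off `S` is a combination of the maps
`Z ↦ (⊗ᵢ Aᵢ)ᴴ Z (⊗ᵢ Bᵢ)` with error operators on `S`. -/
theorem piTensor_eq_sum_siteError (S : Finset J) (Φ : J → Matrix α α ℂ →ₗ[ℂ] Matrix α α ℂ)
    (hΦ : ∀ i ∉ S, Φ i = LinearMap.id) :
    ∃ φ : (J → Option (α × α) × Option (α × α)) → ℂ,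
      (∀ p, φ p ≠ 0 → ∀ i ∉ S, p i = (none, none)) ∧
      ∀ Z, piTensor Φ Z = ∑ p, φ p • ((prodMatrix fun i => siteError (p i).1).conjTranspose * Z *
        prodMatrix fun i => siteError (p i).2) := by
  let ψ : J → Option (α × α) × Option (α × α) → ℂ := fun i p =>
    if i ∈ S then siteCoeff (Φ i) p else if p = (none, none) then 1 else 0
  have hψ : ∀ i Z, Φ i Z =
      ∑ p, ψ i p • ((siteError p.1).conjTranspose * Z * siteError p.2) := by
    intro i Z
    by_cases hi : i ∈ S
    · simp only [ψ, hi, if_true]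
      exact sum_siteCoeff (Φ i) Z
    · simp [ψ, hi, hΦ, siteError]
  refine ⟨fun p => ∏ i, ψ i (p i), fun p hp i hi => ?_, fun Z => ?_⟩
  · have := Finset.prod_ne_zero_iff.mp hp i (Finset.mem_univ i)
    by_contra hne
    simp [ψ, hi, hne] at this
  · let F : Matrix (J → α) (J → α) ℂ →ₗ[ℂ] Matrix (J → α) (J → α) ℂ :=
      { toFun := fun Z => ∑ p : J → Option (α × α) × Option (α × α), (∏ i, ψ i (p i)) •
          ((prodMatrix fun i => siteError (p i).1).conjTranspose * Z *
            prodMatrix fun i => siteError (p i).2)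
        map_add' := fun A B => by
          simp only [Matrix.mul_add, Matrix.add_mul, smul_add, Finset.sum_add_distrib]
        map_smul' := fun c A => by
          simp only [Matrix.mul_smul, Matrix.smul_mul, Finset.smul_sum, RingHom.id_apply,
            smul_comm c] }
    suffices piTensor Φ = F from LinearMap.congr_fun this Z
    refine linearMap_ext_prodMatrix fun X => ?_
    change _ = ∑ p : J → Option (α × α) × Option (α × α), (∏ i, ψ i (p i)) • _
    simp only [piTensor_prodMatrix, prodMatrix_conjTranspose, prodMatrix_mul, hψ]
    ext x y
    simp only [prodMatrix_apply, Matrix.sum_apply, Matrix.smul_apply, smul_eq_mul,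
      ← Finset.prod_mul_distrib]
    rw [Finset.prod_univ_sum, Fintype.piFinset_univ]

/-- For a `t`-error-correcting code there is a decoder that turns every product map acting on at
most `t` sites into a multiple of the identity on the code space. -/
theorem IsErrorCorrecting.exists_decoder [Nonempty Y] [Fintype μ] [Nonempty μ] {t : ℕ}
    {enc : μ → Y → J → α}
    (h : IsErrorCorrecting t enc) :
    ∃ (E : Matrix (J → α) (J → α) ℂ →ₗ[ℂ] Matrix μ μ ℂ)
      (D : Matrix μ μ ℂ →ₗ[ℂ] Matrix (J → α) (J → α) ℂ), IsChannel E ∧ IsChannel D ∧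
      ∀ (S : Finset J) (Φ : J → Matrix α α ℂ →ₗ[ℂ] Matrix α α ℂ), S.card ≤ t →
        (∀ i ∉ S, Φ i = LinearMap.id) → ∃ c : ℂ, ∀ X, E (piTensor Φ (D X)) = c • X := by
  obtain ⟨o⟩ := ‹Nonempty μ›
  let supp : (J → Option (α × α)) → Finset J := fun f => Finset.univ.filter fun i => f i ≠ none
  let A : (J → Option (α × α)) → Matrix (J → α) (J → α) ℂ := fun f =>
    prodMatrix fun i => siteError (f i)
  let V := codeIsometry enc
  let G : (J → Option (α × α)) → (J → Option (α × α)) → ℂ := fun f g =>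
    (Fintype.card Y : ℂ)⁻¹ *
      ∑ y, prodMatrix (fun i => (siteError (f i)).conjTranspose * siteError (g i))
        (enc o y) (enc o y)
  have hG : ∀ f g, (supp f).card ≤ t → (supp g).card ≤ t →
      (A f * V).conjTranspose * (A g * V) = G f g • (1 : Matrix μ μ ℂ) := by
    intro f g hf hg
    have h1 := h.conj_prodMatrix o (S := supp f ∪ supp g)
      (X := fun i => (siteError (f i)).conjTranspose * siteError (g i))
      ((Finset.card_union_le _ _).trans (by omega)) (fun i hi => by
        simp only [supp, Finset.mem_union, Finset.mem_filter, Finset.mem_univ, true_and, not_or,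
          not_not] at hi
        simp [hi.1, hi.2, siteError])
    rw [← h1, ← prodMatrix_mul, ← prodMatrix_conjTranspose, Matrix.conjTranspose_mul]
    simp only [Matrix.mul_assoc, A, V]
  let I := {f : J → Option (α × α) // (supp f).card ≤ t}
  obtain ⟨D, hD, hD'⟩ := QuantumCapacity.exists_decoder (fun f : I => A f.1 * V)
    (Matrix.of fun f g => G f.1 g.1) (fun f g => hG f.1 g.1 f.2 g.2)
  refine ⟨conjMap V, D, isChannel_conjMap h.codeIsometry_conjTranspose_mul, hD,
    fun S Φ hS hΦ => ?_⟩
  obtain ⟨φ, hφ, hφ'⟩ := piTensor_eq_sum_siteError S Φ hΦ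
  refine ⟨∑ p, φ p * G (fun i => (p i).1) (fun i => (p i).2), fun X => ?_⟩
  rw [conjMap_apply, hφ', Matrix.mul_sum, Matrix.sum_mul, Finset.sum_smul]
  refine Finset.sum_congr rfl fun p _ => ?_
  by_cases hp : φ p = 0
  · simp [hp]
  · have h1 : (supp fun i => (p i).1).card ≤ t := (Finset.card_le_card fun i hi => by
      by_contra hiS
      simp [supp, hφ p hp i hiS] at hi).trans hS
    have h2 : (supp fun i => (p i).2).card ≤ t := (Finset.card_le_card fun i hi => by
      by_contra hiS
      simp [supp, hφ p hp i hiS] at hi).trans hS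
    have h3 := hD' ⟨_, h1⟩ ⟨_, h2⟩ X
    simp only [Matrix.of_apply] at h3
    rw [mul_smul, ← h3, Matrix.mul_smul, Matrix.smul_mul, Matrix.conjTranspose_mul]
    simp only [Matrix.mul_assoc, A]

/-- Coding with a `t`-error-correcting code for `J` uses of a map `ε`-close to the identity leaves
only the terms of the binomial expansion with more than `t` errors. -/
theorem IsErrorCorrecting.exists_cbBound [Nonempty Y] [Fintype μ] [Nonempty μ] {t : ℕ}
    {enc : μ → Y → J → α}
    (h : IsErrorCorrecting t enc) {R : Matrix α α ℂ →ₗ[ℂ] Matrix α α ℂ} (hR : R 1 = 1) {ε : ℝ}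
    (hε0 : 0 ≤ ε) (hε1 : ε ≤ 1) (hRε : CBBound (R - LinearMap.id) ε) :
    ∃ (E : Matrix (J → α) (J → α) ℂ →ₗ[ℂ] Matrix μ μ ℂ)
      (D : Matrix μ μ ℂ →ₗ[ℂ] Matrix (J → α) (J → α) ℂ), IsChannel E ∧ IsChannel D ∧
      CBBound (E ∘ₗ piTensor (fun _ : J => R) ∘ₗ D - LinearMap.id)
        (2 ^ Fintype.card J * ε ^ (t + 1)) := by
  obtain ⟨E, D, hE, hD, hED⟩ := h.exists_decoder
  refine ⟨E, D, hE, hD, ?_⟩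
  let Φ : Finset J → J → Matrix α α ℂ →ₗ[ℂ] Matrix α α ℂ := fun S i =>
    if i ∈ S then R - LinearMap.id else LinearMap.id
  have h0 : E ∘ₗ piTensor (Φ ∅) ∘ₗ D = LinearMap.id := by
    obtain ⟨c, hc⟩ := hED ∅ (Φ ∅) (by simp) (by simp [Φ])
    have h1 := hc 1
    have h2 : piTensor (Φ ∅) = LinearMap.id := by simp [Φ, piTensor_id]
    rw [h2, LinearMap.id_apply, hD.map_one, hE.map_one] at h1
    refine LinearMap.ext fun X => (hc X).trans ?_
    calc c • X = c • (1 * X) := by rw [Matrix.one_mul]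
      _ = X := by rw [← Matrix.smul_mul, ← h1, Matrix.one_mul]
  -- The multiple of the identity is found by evaluation at `1`, which `R - id` annihilates.
  have hsmall : ∀ S : Finset J, S.card ≤ t → S ≠ ∅ → E ∘ₗ piTensor (Φ S) ∘ₗ D = 0 := by
    intro S hS hne
    obtain ⟨c, hc⟩ := hED S (Φ S) hS (fun i hi => by simp [Φ, hi])
    obtain ⟨i, hi⟩ := Finset.nonempty_iff_ne_empty.mpr hne
    have h1 := hc 1
    have h2 : piTensor (Φ S) 1 = 0 := by
      rw [← prodMatrix_one, piTensor_prodMatrix]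
      ext x y
      exact Finset.prod_eq_zero (Finset.mem_univ i) (by simp [Φ, hi, hR])
    rw [hD.map_one, h2, map_zero] at h1
    refine LinearMap.ext fun X => (hc X).trans ?_
    calc c • X = c • (1 * X) := by rw [Matrix.one_mul]
      _ = 0 := by rw [← Matrix.smul_mul, ← h1, Matrix.zero_mul]
  have hsum : E ∘ₗ piTensor (fun _ : J => R) ∘ₗ D - LinearMap.id =
      ∑ S ∈ Finset.univ.filter (fun S : Finset J => t < S.card), E ∘ₗ piTensor (Φ S) ∘ₗ D := by
    have h1 : E ∘ₗ piTensor (fun _ : J => R) ∘ₗ D = ∑ S : Finset J, E ∘ₗ piTensor (Φ S) ∘ₗ D := by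
      rw [piTensor_eq_sum_powerset]
      ext X : 1
      simp [Φ, LinearMap.sum_apply]
    rw [h1, sub_eq_iff_eq_add, ← Finset.sum_filter_add_sum_filter_not Finset.univ
      (fun S : Finset J => t < S.card)]
    congr 1
    rw [Finset.sum_eq_single ∅, h0]
    · intro S hS hne
      exact hsmall S (not_lt.mp (Finset.mem_filter.mp hS).2) hne
    · simp
  rw [hsum]
  refine (CBBound.sum (c := fun _ => ε ^ (t + 1)) fun S hS => ?_).mono ?_
  · have h1 := (hE.cbBound.comp zero_le_one
      ((cbBound_piTensor_ite hε0 hRε S).comp (pow_nonneg hε0 _) hD.cbBound))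
    rw [one_mul, mul_one] at h1
    exact h1.mono (pow_le_pow_of_le_one hε0 hε1 (Finset.mem_filter.mp hS).2)
  · rw [Finset.sum_const, nsmul_eq_mul]
    refine mul_le_mul_of_nonneg_right ?_ (pow_nonneg hε0 _)
    have := Finset.card_filter_le (Finset.univ : Finset (Finset J)) fun S => t < S.card
    rw [Finset.card_univ, Fintype.card_finset] at this
    exact_mod_cast this

end Code

/-! ### Comparison of the capacities -/

section Capacity

variable {κ ι : Type*} [Fintype κ] [DecidableEq κ] [Fintype ι] [DecidableEq ι]

theorem capacity_le_capacityWithError (T : Matrix κ κ ℂ →ₗ[ℂ] Matrix ι ι ℂ) {ε : ℝ} (hε : 0 < ε) :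
    capacity T ≤ capacityWithError ε T := by
  refine iSup₂_le fun c hc => le_iSup₂_of_le c ?_ le_rfl
  have h1 := ENNReal.tendsto_nhds_zero.mp hc (ENNReal.ofReal ε) (ENNReal.ofReal_pos.mpr hε)
  filter_upwards [h1] with n hn
  refine (codingError_mono _ (by positivity) (Nat.le_floor ?_)).trans hn
  push_cast
  rw [← Real.rpow_natCast]
  exact Real.rpow_le_rpow_of_exponent_le one_le_two (Nat.floor_le (by positivity))

/-- Concatenation: codes of error less than `δ` for blocks of `n` channel uses are used `m` times,
as letters of a Reed–Solomon code correcting `t` errors. -/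
theorem codingError_tensorPower_concat_le [Nonempty ι] {T : Matrix κ κ ℂ →ₗ[ℂ] Matrix ι ι ℂ}
    (hT : IsChannel T) {n l m t N : ℕ} {δ : ℝ} (hδ0 : 0 ≤ δ) (hδ1 : δ ≤ 1)
    (h : codingError (tensorPower T n) (2 ^ l) < ENNReal.ofReal δ) (hl : l ≠ 0) (hml : m ≤ 2 ^ l)
    (hm : 4 * t ≤ m) (hN : m * n ≤ N) :
    codingError (tensorPower T N) ((2 ^ l) ^ (m - 4 * t)) ≤
      ENNReal.ofReal (2 ^ m * δ ^ (t + 1)) := by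
  obtain ⟨E, D, hE, hD, hED⟩ := exists_of_codingError_lt hδ0 h
  obtain ⟨E₀, D₀, hE₀, hD₀, h₀⟩ := exists_simulation_tensorPower hT hN
  obtain ⟨enc, henc⟩ := exists_isErrorCorrecting hl hml hm
  have hTn : IsChannel (tensorPower T n) := isChannel_piTensor hT
  have : Nonempty (Fin ((2 ^ l) ^ (m - 4 * t))) := ⟨⟨0, by positivity⟩⟩
  have : Nonempty (Fin (2 ^ l)) := ⟨⟨0, by positivity⟩⟩
  obtain ⟨E', D', hE', hD', h'⟩ := henc.exists_cbBound (hE.comp (hTn.comp hD)).map_one hδ0 hδ1 hED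
  rw [Fintype.card_fin] at h'
  have hpi : piTensor (fun _ : Fin m => E ∘ₗ tensorPower T n ∘ₗ D) =
      piTensor (fun _ => E) ∘ₗ tensorPower (tensorPower T n) m ∘ₗ piTensor fun _ => D := by
    rw [tensorPower_eq_piTensor (tensorPower T n), piTensor_comp, piTensor_comp]
  refine (codingError_le_codingError_comp _ hE₀ hD₀ _).trans ?_
  rw [h₀]
  refine (codingError_le_codingError_comp _ (isChannel_piTensor hE) (isChannel_piTensor hD) _).trans
    ?_
  rw [← hpi]
  exact codingError_le_of_cbBound (by positivity) hE' hD' h'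

/-- A rate achievable with a small error `ε` gives rates achievable with vanishing error, at the
cost of the factor `s / (s + 4)`, the rate of the outer code. -/
theorem IsAchievableRateWithError.isAchievableRate [Nonempty ι]
    {T : Matrix κ κ ℂ →ₗ[ℂ] Matrix ι ι ℂ} (hT : IsChannel T) {ε : ℝ} (hε : 0 < ε) {s : ℕ}
    (hs : 2 ^ (s + 5) * ε < 1) {c c' : ℝ≥0} (hc : IsAchievableRateWithError ε T c)
    (hcc : (c' : ℝ) * (s + 4) < c * s) : IsAchievableRate T c' := by
  have hs0 : (0 : ℝ) ≤ s := Nat.cast_nonneg s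
  have hc0 : (0 : ℝ) < c := by
    by_contra h
    have h1 : (c : ℝ) = 0 := le_antisymm (not_lt.mp h) c.2
    rw [h1, zero_mul] at hcc
    exact absurd hcc (not_lt.mpr (by positivity))
  have h2ε : 2 ^ (s + 4) * (2 * ε) < 1 := by
    calc 2 ^ (s + 4) * (2 * ε) = 2 ^ (s + 5) * ε := by ring
      _ < 1 := hs
  have hε1 : 2 * ε ≤ 1 := by
    have : (1 : ℝ) ≤ 2 ^ (s + 4) := one_le_pow₀ one_le_two
    nlinarith
  refine ENNReal.tendsto_nhds_zero.mpr fun η hη => ?_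
  -- With `m = (s + 4) t` blocks, the error bound `2 ^ m (2ε) ^ (t + 1)` decays
  -- exponentially in `t`.
  obtain ⟨t, ht0, ht⟩ : ∃ t : ℕ, 0 < t ∧
      ENNReal.ofReal ((2 ^ (s + 4) * (2 * ε)) ^ t) ≤ η := by
    have h1 : Tendsto (fun t : ℕ => ENNReal.ofReal ((2 ^ (s + 4) * (2 * ε)) ^ t)) atTop (𝓝 0) := by
      simpa using ENNReal.tendsto_ofReal
        (tendsto_pow_atTop_nhds_zero_of_lt_one (by positivity) h2ε)
    exact ((eventually_gt_atTop 0).and (ENNReal.tendsto_nhds_zero.mp h1 η hη)).exists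
  set m := (s + 4) * t with hm
  have hm0 : 0 < m := by positivity
  have hdiv : Tendsto (fun N : ℕ => N / m) atTop atTop :=
    Nat.tendsto_div_const_atTop hm0.ne'
  have hfloor : Tendsto (fun n : ℕ => ⌊(c : ℝ) * n⌋₊) atTop atTop :=
    tendsto_nat_floor_atTop.comp (tendsto_natCast_atTop_atTop.const_mul_atTop hc0)
  have hlin : ∀ᶠ N : ℕ in atTop, (c + 1) * (s * t * (s + 4)) ≤ (c * s - c' * (s + 4)) * (N : ℝ) :=
    (tendsto_natCast_atTop_atTop.const_mul_atTop (sub_pos.mpr hcc)).eventually_ge_atTop _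
  filter_upwards [hdiv.eventually hc, (hfloor.comp hdiv).eventually_ge_atTop (m + 1), hlin]
    with N h1 h2 h3
  simp only [Function.comp_apply] at h2
  set n := N / m with hn
  set l := ⌊(c : ℝ) * n⌋₊ with hl
  have hlt : m < 2 ^ l := (Nat.lt_of_succ_le h2).trans Nat.lt_two_pow_self
  have h4 := codingError_tensorPower_concat_le (N := N) hT (δ := 2 * ε) (m := m) (t := t)
    (by positivity) hε1 (h1.trans_lt ((ENNReal.ofReal_lt_ofReal_iff (by positivity)).mpr
      (by linarith))) (by omega) hlt.le (by rw [hm]; gcongr; omega) (Nat.mul_div_le N m)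
  have hk : m - 4 * t = s * t := by rw [hm, add_mul]; omega
  rw [hk, ← pow_mul] at h4
  have hrate : (c' : ℝ) * N ≤ l * (s * t) := by
    have hl1 : (c : ℝ) * n - 1 ≤ l := (Nat.sub_one_lt_floor _).le
    have hn1 : (N : ℝ) ≤ m * (n + 1) := by
      exact_mod_cast (Nat.lt_mul_div_succ N hm0).le
    have hmr : (m : ℝ) = (s + 4) * t := by rw [hm]; push_cast; ring
    have ht1 : (0 : ℝ) < t := by exact_mod_cast ht0
    have hA : ((c : ℝ) * n - 1) * (s * t) ≤ l * (s * t) :=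
      mul_le_mul_of_nonneg_right hl1 (by positivity)
    refine le_trans ?_ hA
    rw [hmr] at hn1
    have hB : (c : ℝ) * s * N ≤ c * s * ((s + 4) * t * (n + 1)) :=
      mul_le_mul_of_nonneg_left hn1 (by positivity)
    refine le_of_mul_le_mul_right (a := (s : ℝ) + 4) ?_ (by positivity)
    linarith
  refine (codingError_mono _ (Nat.floor_pos.mpr (Real.one_le_rpow one_le_two (by positivity)))
    (Nat.floor_le_of_le ?_)).trans (h4.trans (le_trans (ENNReal.ofReal_le_ofReal ?_) ht))
  · push_cast
    rw [← Real.rpow_natCast]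
    refine Real.rpow_le_rpow_of_exponent_le one_le_two ?_
    push_cast
    exact hrate
  · rw [mul_pow (2 ^ (s + 4)), hm, ← pow_mul]
    exact mul_le_mul_of_nonneg_left (pow_le_pow_of_le_one (by positivity) hε1 (Nat.le_succ t))
      (by positivity)

theorem capacityWithError_le [Nonempty ι] {T : Matrix κ κ ℂ →ₗ[ℂ] Matrix ι ι ℂ} (hT : IsChannel T)
    {ε : ℝ} (hε : 0 < ε) {s : ℕ} (hs0 : s ≠ 0) (hs : 2 ^ (s + 5) * ε < 1) :
    capacityWithError ε T ≤ capacity T * ((1 + 4 / s : ℝ≥0) : ℝ≥0∞) := by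
  refine iSup₂_le fun c hc => ?_
  have hs' : (s : ℝ≥0) ≠ 0 := by exact_mod_cast hs0
  have h1 : ((c * (s / (s + 4)) : ℝ≥0) : ℝ≥0∞) ≤ capacity T := by
    refine ENNReal.le_of_forall_nnreal_lt fun c' hc' => ?_
    refine le_iSup₂_of_le c' (hc.isAchievableRate hT hε hs ?_) le_rfl
    have h2 : c' < c * (s / (s + 4)) := by exact_mod_cast hc'
    rw [← mul_div_assoc, lt_div_iff₀ (by positivity)] at h2
    exact_mod_cast h2
  have h3 : c = c * (s / (s + 4)) * (1 + 4 / s) := by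
    field_simp
  calc (c : ℝ≥0∞) = ((c * (s / (s + 4)) : ℝ≥0) : ℝ≥0∞) * ((1 + 4 / s : ℝ≥0) : ℝ≥0∞) := by
        rw [← ENNReal.coe_mul, ← h3]
    _ ≤ _ := mul_le_mul_left h1 _

theorem tendsto_capacityWithError [Nonempty ι] {T : Matrix κ κ ℂ →ₗ[ℂ] Matrix ι ι ℂ}
    (hT : IsChannel T) :
    Tendsto (fun ε : ℝ => capacityWithError ε T) (𝓝[>] 0) (𝓝 (capacity T)) := by
  refine tendsto_order.mpr ⟨fun a ha => ?_, fun a ha => ?_⟩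
  · filter_upwards [self_mem_nhdsWithin] with ε hε
    exact ha.trans_le (capacity_le_capacityWithError T hε)
  · have h1 : Tendsto (fun s : ℕ => (1 + 4 / s : ℝ≥0)) atTop (𝓝 1) := by
      simpa using (tendsto_const_div_atTop_nhds_zero_nat (𝕜 := ℝ≥0) 4).const_add 1
    have h2 : Tendsto (fun s : ℕ => capacity T * ((1 + 4 / s : ℝ≥0) : ℝ≥0∞)) atTop
        (𝓝 (capacity T)) := by
      simpa using ENNReal.Tendsto.const_mul (a := capacity T) (ENNReal.tendsto_coe.mpr h1)
        (Or.inl (by simp))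
    obtain ⟨s, hs0, hs⟩ := ((eventually_ne_atTop 0).and (h2.eventually_lt_const ha)).exists
    have hpos : (0 : ℝ) < (2 ^ (s + 5))⁻¹ := by positivity
    filter_upwards [Ioo_mem_nhdsGT hpos] with ε hε
    refine (capacityWithError_le hT hε.1 hs0 ?_).trans_lt hs
    rw [← lt_inv_mul_iff₀ (by positivity), mul_one]
    exact hε.2

end Capacity

end QuantumCapacity

/-- For every channel `T : B(ℂ^κ) → B(ℂ^ι)` between nonzero finite-dimensional systems,
`Q_ε(T) → Q(T)` as `ε → 0`, `ε > 0`. -/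
theorem mainTheorem5 {κ ι : Type*} [Fintype κ] [DecidableEq κ] [Nonempty κ]
    [Fintype ι] [DecidableEq ι] [Nonempty ι]
    (T : Matrix κ κ ℂ →ₗ[ℂ] Matrix ι ι ℂ) (hT : QuantumCapacity.IsChannel T) :
    Filter.Tendsto (fun ε : ℝ => QuantumCapacity.capacityWithError ε T)
      (nhdsWithin 0 (Set.Ioi 0)) (nhds (QuantumCapacity.capacity T)) :=
  QuantumCapacity.tendsto_capacityWithError hT
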